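/- **Setting.** Let $(\Omega,\Xi,\mu)$ be a probability space with an ergodic dynamical system $\mathcal T(x):\Omega\to\Omega$, $x\in\mathbb R^n$: $\mathcal T(0)=\mathrm{id}$, $\mathcal T(x+y)=\mathcal T(x)\mathcal T(y)$, each $\mathcal T(x)$ preserves $\mu$, $\{(x,\omega):\mathcal T(x)\omega\in A\}$ is (Lebesgue $\times\,\Xi$)-measurable for every $A\in\Xi$, and every $A\in\Xi$ with $\mu(\mathcal T(x)A\,\triangle\,A)=0$ for all $x$ has measure $0$ or $1$. Let $\mathcal F\in\Xi$ with $\mu(\mathcal F)>0$ and $\mu(\Omega\setminus\mathcal F)>0$. Put $F(\omega)=\{x\in\mathbb R^n:\mathcal T(x)\omega\in\mathcal F\}$, assumed open and connected almost surely, and $M(\omega)=\mathbb R^n\setminus F(\omega)$. The connected components $M_j(\omega)$ of $M(\omega)$ are called grains, and it is assumed that there are deterministic constants $K$, $r>0$, $\delta>0$, $d_0$ such that almost surely: * (R1) every grain is the closure of a bounded domain with $C^2$ boundary; * (R2) all normal curvatures of the boundaries of the grains are at most $K$ in absolute value, and every boundary point of a grain $M_j(\omega)$ lies on the boundary of a ball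 of radius $r$ whose interior does not meet $M_j(\omega)$; * (R3) distinct grains have distance at least $\delta$; * (R4) every grain has diameter at most $d_0$. Let $G\subset\mathbb R^n$ be a bounded domain with smooth boundary. For $\varepsilon>0$ let $\mathcal J(\varepsilon)$ be the set of those $j$ with $\varepsilon M_j(\omega)\subset\{x\in G:\operatorname{dist}(x,\partial G)\ge\varepsilon\}$, and put $$G_f^\varepsilon(\omega)=G\setminus\overline{\bigcup_{j\in\mathcal J(\varepsilon)}\varepsilon M_j(\omega)},\qquad G_f(\omega)=\tfrac1\varepsilon G_f^\varepsilon(\omega),\qquad S(\omega)=\bigcup_{j\in\mathcal J(\varepsilon)}\partial M_j(\omega).$$ Let $\beta>0$, $N_\sigma\in\mathbb R$, let $z_1<\dots<z_N$ be integers with $z_1<0<z_N$, and let $n_1^c,\dots,n_N^c>0$ satisfy the electroneutrality condition $\sum_{j=1}^N z_jn_j^c=0$. Let $\sigma(\cdot)=\sigma(\cdot,\omega)$ be a random surface charge such that almost surely $\sigma$ is measurable on $\partial F(\omega)$ with respect to the surface measure, with $\|\sigma\|_{L^\infty(\partial F(\omega))}\le C_0$ for a deterministic $C_0$. Consider the problem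 $$-\Delta\Psi^\varepsilon=\beta\sum_{j=1}^N z_jn_j^c\,e^{-z_j\Psi^\varepsilon}\ \text{ in }G_f(\omega),\qquad \nabla\Psi^\varepsilon\cdot\nu=-N_\sigma\sigma\ \text{ on }S(\omega),\qquad \Psi^\varepsilon=0\ \text{ on }\tfrac1\varepsilon\partial G,\tag{PB}$$ where $\nu$ is the unit normal exterior to $G_f(\omega)$. A solution is a function $\Psi^\varepsilon\in H^1(G_f(\omega))\cap L^\infty(G_f(\omega))$ that vanishes on $\frac1\varepsilon\partial G$ (it is the $H^1(G_f(\omega))$-limit of restrictions of functions in $C_c^\infty(\frac1\varepsilon G)$) and satisfies, for all $\varphi\in C_c^\infty(\frac1\varepsilon G)$, $$\int_{G_f(\omega)}\nabla\Psi^\varepsilon\cdot\nabla\varphi\,dy=\beta\int_{G_f(\omega)}\sum_{j=1}^N z_jn_j^c\,e^{-z_j\Psi^\varepsilon}\varphi\,dy-N_\sigma\int_{S(\omega)}\sigma\varphi\,dS.$$ **Theorem.** There is a deterministic constant $C$, independent of $\varepsilon$, such that almost surely, for every $\varepsilon>0$, problem (PB) has a unique solution $\Psi^\varepsilon\in H^1(G_f(\omega))\cap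 L^\infty(G_f(\omega))$, and this solution satisfies $$\int_{G_f(\omega)}\big(|\nabla\Psi^\varepsilon|^2+|\Psi^\varepsilon|^2\big)\,dy\le C\,|G_f(\omega)|,\qquad \|\Psi^\varepsilon\|_{L^\infty(G_f(\omega))}\le C.$$ -/

import Mathlib

open MeasureTheory Filter Topology
open scoped Pointwise

noncomputable section

namespace PoissonBoltzmann

/-- The Euclidean space `ℝⁿ`. -/
abbrev E (n : ℕ) : Type := EuclideanSpace ℝ (Fin n)

/-! ### Domains with smooth boundary and the curvature of their boundary -/

/-- `φ` is a `C^k` defining function of the open set `D` in the neighbourhood `U` of the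
boundary point `p`: near `p` the set `D` is the strict sublevel set `{φ < 0}`, and `∇φ(p) ≠ 0`. -/
structure IsLocalDefiningFunction {n : ℕ} (k : WithTop ℕ∞) (D : Set (E n)) (p : E n)
    (U : Set (E n)) (φ : E n → ℝ) : Prop where
  isOpen : IsOpen U
  mem : p ∈ U
  contDiffOn : ContDiffOn ℝ k φ U
  fderiv_ne_zero : fderiv ℝ φ p ≠ 0
  inter_eq : D ∩ U = {x ∈ U | φ x < 0}

/-- A bounded domain (non-empty connected open set) with `C^k` boundary. -/
structure IsBoundedDomain {n : ℕ} (k : WithTop ℕ∞) (D : Set (E n)) : Prop where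
  isOpen : IsOpen D
  isConnected : IsConnected D
  isBounded : Bornology.IsBounded D
  boundary : ∀ p ∈ frontier D, ∃ U φ, IsLocalDefiningFunction k D p U φ

/-- All normal curvatures of the boundary of the `C²` domain `D` are at most `K` in absolute
value. In terms of a defining function, the normal curvature at `p` in the unit tangent
direction `v` is `± D²φ(p)(v,v) / |∇φ(p)|`; it does not depend on the defining function. -/
def CurvatureBoundedBy {n : ℕ} (D : Set (E n)) (K : ℝ) : Prop :=
  ∀ p ∈ frontier D, ∀ U φ, IsLocalDefiningFunction 2 D p U φ →
    ∀ v : E n, fderiv ℝ φ p v = 0 →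
      |fderiv ℝ (fderiv ℝ φ) p v v| ≤ K * ‖fderiv ℝ φ p‖ * ‖v‖ ^ 2

/-- Every boundary point of `C` lies on the boundary of an open ball of radius `r` that does not
meet `C`. -/
def ExteriorBallCondition {n : ℕ} (C : Set (E n)) (r : ℝ) : Prop :=
  ∀ p ∈ frontier C, ∃ c : E n, dist c p = r ∧ Disjoint (Metric.ball c r) C

/-! ### The random medium -/

/-- An ergodic, measure-preserving dynamical system with `n`-dimensional time on the
probability space `(Ω, μ)`. In `measurable'`, `ℝⁿ` carries the Lebesgue σ-algebra. -/
structure IsErgodicFlow {n : ℕ} {Ω : Type*} [MeasurableSpace Ω] (μ : Measure Ω)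
    (T : E n → Ω → Ω) : Prop where
  map_zero : T 0 = id
  map_add : ∀ x y, T (x + y) = T x ∘ T y
  measurePreserving : ∀ x, MeasurePreserving (T x) μ μ
  measurable' : ∀ A : Set Ω, MeasurableSet A →
    MeasurableSet {p : NullMeasurableSpace (E n) (volume : Measure (E n)) × Ω | T p.1 p.2 ∈ A}
  ergodic : ∀ A : Set Ω, MeasurableSet A →
    (∀ x, μ (((T x '' A) ∪ A) \ ((T x '' A) ∩ A)) = 0) → μ A = 0 ∨ μ A = 1

/-- The pore structure `F(ω) = {x | T(x)ω ∈ 𝓕}`. -/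
def poreSpace {n : ℕ} {Ω : Type*} (T : E n → Ω → Ω) (𝓕 : Set Ω) (ω : Ω) : Set (E n) :=
  {x | T x ω ∈ 𝓕}

/-- The solid skeleton `M(ω) = ℝⁿ \ F(ω)`. -/
def skeleton {n : ℕ} {Ω : Type*} (T : E n → Ω → Ω) (𝓕 : Set Ω) (ω : Ω) : Set (E n) :=
  (poreSpace T 𝓕 ω)ᶜ

/-- The grains, that is, the connected components of the solid set `M`. -/
def grains {n : ℕ} (M : Set (E n)) : Set (Set (E n)) :=
  {C | ∃ x ∈ M, C = connectedComponentIn M x}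

/-- Random disperse media: the conditions R1, R2, R3, R4 on the random closed set `M(ω)`. -/
structure IsDisperseMedium {n : ℕ} {Ω : Type*} [MeasurableSpace Ω] (μ : Measure Ω)
    (M : Ω → Set (E n)) : Prop where
  /-- R1: the grains are (closures of) bounded domains of class `C²`. -/
  smooth : ∀ᵐ ω ∂μ, ∀ C ∈ grains (M ω),
    IsBoundedDomain 2 (interior C) ∧ closure (interior C) = C
  /-- R2: the boundaries of the grains have curvature radius bounded below, by a deterministic
  constant: the normal curvatures are bounded, and the boundary of a grain does not come back
  arbitrarily close to itself through the fluid. -/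
  curvature : ∃ K r : ℝ, 0 < r ∧ ∀ᵐ ω ∂μ, ∀ C ∈ grains (M ω),
    CurvatureBoundedBy (interior C) K ∧ ExteriorBallCondition C r
  /-- R3: distinct grains have at least a deterministic positive distance. -/
  separated : ∃ δ : ℝ, 0 < δ ∧ ∀ᵐ ω ∂μ, ∀ C ∈ grains (M ω), ∀ C' ∈ grains (M ω), C ≠ C' →
    ∀ x ∈ C, ∀ y ∈ C', δ ≤ dist x y
  /-- R4: the diameters of the grains have a deterministic bound. -/
  diam : ∃ d : ℝ, ∀ᵐ ω ∂μ, ∀ C ∈ grains (M ω), ∀ x ∈ C, ∀ y ∈ C, dist x y ≤ d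

/-! ### The perforated domain -/

/-- `G₁^ε = {x ∈ G | dist(x, ∂G) ≥ ε}`. -/
def innerRegion {n : ℕ} (G : Set (E n)) (ε : ℝ) : Set (E n) :=
  {x ∈ G | ε ≤ Metric.infDist x (frontier G)}

/-- The grains `C` of `M` with `ε C ⊆ G₁^ε`. -/
def retainedGrains {n : ℕ} (G M : Set (E n)) (ε : ℝ) : Set (Set (E n)) :=
  {C ∈ grains M | ε • C ⊆ innerRegion G ε}

/-- `G_f^ε`: the domain `G` without the retained grains scaled by `ε`. -/
def fluidDomain {n : ℕ} (G M : Set (E n)) (ε : ℝ) : Set (E n) :=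
  G \ closure (⋃ C ∈ retainedGrains G M ε, ε • C)

/-- The rescaled fluid domain `G_f = ε⁻¹ G_f^ε`. -/
def rescaledFluidDomain {n : ℕ} (G M : Set (E n)) (ε : ℝ) : Set (E n) :=
  ε⁻¹ • fluidDomain G M ε

/-- The rescaled fluid-solid interface, the union of the boundaries of the retained grains. -/
def interface {n : ℕ} (G M : Set (E n)) (ε : ℝ) : Set (E n) :=
  ⋃ C ∈ retainedGrains G M ε, frontier C

/-- The surface measure on hypersurfaces of `ℝⁿ`: the normalized `(n-1)`-dimensional Hausdorff
measure. -/
def surfaceMeasure (n : ℕ) : Measure (E n) :=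
  Measure.euclideanHausdorffMeasure (n - 1)

/-! ### Sobolev functions -/

/-- Smooth functions with compact support contained in the open set `U`. -/
structure IsTestFunction {n : ℕ} (U : Set (E n)) (φ : E n → ℝ) : Prop where
  contDiff : ContDiff ℝ (⊤ : ℕ∞) φ
  hasCompactSupport : HasCompactSupport φ
  tsupport_subset : tsupport φ ⊆ U

/-- `u ∈ H¹(U)` with weak gradient `g`. -/
structure MemH1 {n : ℕ} (U : Set (E n)) (u : E n → ℝ) (g : E n → E n) : Prop where
  memLp : MemLp u 2 (volume.restrict U)
  memLp_grad : MemLp g 2 (volume.restrict U)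
  weak : ∀ φ, IsTestFunction U φ →
    ∫ x in U, u x • gradient φ x = -∫ x in U, φ x • g x

/-- For `U ⊆ V`, the function `u ∈ H¹(U)` with weak gradient `g` vanishes on `∂V`: it is the limit
in `H¹(U)` of smooth functions with compact support in `V`. No condition is imposed on the part
of `∂U` that lies in `V`. -/
def VanishesOnOuterBoundary {n : ℕ} (U V : Set (E n)) (u : E n → ℝ) (g : E n → E n) : Prop :=
  ∃ φ : ℕ → E n → ℝ, (∀ k, IsTestFunction V (φ k)) ∧
    Tendsto (fun k => eLpNorm (fun x => φ k x - u x) 2 (volume.restrict U)) atTop (𝓝 0) ∧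
    Tendsto (fun k => eLpNorm (fun x => gradient (φ k) x - g x) 2 (volume.restrict U))
      atTop (𝓝 0)

/-! ### The Poisson-Boltzmann problem -/

/-- The scaled charge density `∑ j, z_j n_j^c exp(-z_j s)`, that is, `-n_H(s)`. -/
def chargeDensity {m : ℕ} (z : Fin m → ℤ) (nc : Fin m → ℝ) (s : ℝ) : ℝ :=
  ∑ j, (z j : ℝ) * nc j * Real.exp (-(z j : ℝ) * s)

/-- `u`, with weak gradient `g`, is a weak solution in `H¹ ∩ L^∞` of
`-Δu = β ∑ j, z_j n_j^c exp(-z_j u)` in `ε⁻¹ G_f^ε`, `∇u · ν = -N_σ σ` on the fluid-solid interface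
(`ν` the unit normal exterior to the fluid), `u = 0` on `ε⁻¹ ∂G`. -/
structure IsSolution {n m : ℕ} (G M : Set (E n)) (ε β Nσ : ℝ) (z : Fin m → ℤ) (nc : Fin m → ℝ)
    (σ : E n → ℝ) (u : E n → ℝ) (g : E n → E n) : Prop where
  memH1 : MemH1 (rescaledFluidDomain G M ε) u g
  memLinfty : MemLp u ⊤ (volume.restrict (rescaledFluidDomain G M ε))
  dirichlet : VanishesOnOuterBoundary (rescaledFluidDomain G M ε) (ε⁻¹ • G) u g
  equation : ∀ φ, IsTestFunction (ε⁻¹ • G) φ →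
    ∫ y in rescaledFluidDomain G M ε, inner ℝ (g y) (gradient φ y) =
      β * (∫ y in rescaledFluidDomain G M ε, chargeDensity z nc (u y) * φ y)
        - Nσ * ∫ y in interface G M ε, σ y * φ y ∂(surfaceMeasure n)

end PoissonBoltzmann

end

/-! The function `f s = -β * chargeDensity z nc s` satisfies `f 0 = 0` by electroneutrality and `f'
≥ c > 0`, since ions of both signs are present. The problem is thus strongly monotone, with `c`
independent of the geometry. What is left is to control the boundary integral of the surface charge
by the volume of the fluid, with constants that depend neither on `ω` nor on `ε`.

This is done by a barrier `W` that needs no regularity of the interface. By the exterior ball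
condition and the separation of the grains, every interface point is touched by a ball of radius `ρ
= min r (δ / 2)` that misses all retained grains. Let `W` be the maximum of zero and the supremum,
over the centres `c` of such balls, of the paraboloids `(ρ² - |x - c|²) / (2ρ)`. It vanishes on the
grains, is 1-Lipschitz and semiconvex, so that `ΔW ≥ -n/ρ` as a distribution, and `|∇W|² = 1 - 2W/ρ`
almost everywhere on `{W > 0}`. Testing the inequality for `ΔW` with `W / (W + t) * φ` bounds `t⁻¹`
times the integral of `φ` over the layer `{0 < W < t}`. A Vitali covering bounds the surface measure
by a multiple of the lower limit of these normalized layer volumes. Together they give, for `φ ≥ 0`,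
the one-sided trace inequality `∫_S φ ≤ c_B ∫ (κ φ - ∇W · ∇φ)` over the fluid, with `κ` and `c_B`
depending only on `n` and `ρ` (`exists_isBarrier`).

This inequality is used twice. With Cauchy-Schwarz it bounds the boundary functional on `H¹` by a
multiple of the square root of the fluid volume, whence the energy estimate. Its right-hand side is
also the weak form of `ΔW + κ`, so comparison with `m + Aρ - A W` gives a supremum bound `Λ` that
involves the nonlinearity only through `c` (`ae_le_of_subsolution`). Therefore `f` may be replaced
beyond `[-Λ, Λ]` by a globally Lipschitz, strongly monotone function. The modified problem is solved
by a contraction in a Hilbert space (`exists_mem_h1Space_of_strongly_monotone`), and its solution,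
staying below `Λ` in absolute value, solves the original one. Uniqueness follows by testing the
difference of two equations with approximations of the difference of the solutions; the boundary
terms cancel. -/

noncomputable section

namespace PoissonBoltzmann

/-! ### A semiconvex substitute for the distance function -/

section Collar

variable {X : Type*} [NormedAddCommGroup X]

/-- A bounded function that is positive exactly at the points at distance less than `ρ` from `D`.
If `D` is the set of the centres of the balls of radius `ρ` that do not meet `M`, it behaves like
the distance from `M` close to `M`. -/
def collar (D : Set X) (ρ : ℝ) (x : X) : ℝ :=
  (ρ ^ 2 - min (Metric.infDist x D) ρ ^ 2) / (2 * ρ)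

variable {D : Set X} {ρ : ℝ}

lemma collar_nonneg (hρ : 0 < ρ) (x : X) : 0 ≤ collar D ρ x := by
  have h1 : 0 ≤ min (Metric.infDist x D) ρ := le_min Metric.infDist_nonneg hρ.le
  have h2 : min (Metric.infDist x D) ρ ≤ ρ := min_le_right _ _
  unfold collar
  apply div_nonneg _ (by positivity)
  nlinarith

lemma collar_le (hρ : 0 < ρ) (x : X) : collar D ρ x ≤ ρ / 2 := by
  unfold collar
  rw [div_le_div_iff₀ (by positivity) (by positivity)]
  nlinarith [sq_nonneg (min (Metric.infDist x D) ρ)]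

lemma infDist_lt_of_collar_pos {x : X} (h : 0 < collar D ρ x) :
    Metric.infDist x D < ρ := by
  by_contra! hc
  simp [collar, min_eq_right hc] at h

lemma lipschitzWith_collar (hρ : 0 < ρ) : LipschitzWith 1 (collar D ρ) := by
  apply LipschitzWith.of_dist_le_mul
  intro x y
  have hL : |min (Metric.infDist x D) ρ - min (Metric.infDist y D) ρ| ≤ dist x y := by
    have := ((Metric.lipschitz_infDist_pt D).min_const ρ).dist_le_mul x y
    simpa [Real.dist_eq] using this
  have hx1 : 0 ≤ min (Metric.infDist x D) ρ := le_min Metric.infDist_nonneg hρ.le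
  have hx2 : min (Metric.infDist x D) ρ ≤ ρ := min_le_right _ _
  have hy1 : 0 ≤ min (Metric.infDist y D) ρ := le_min Metric.infDist_nonneg hρ.le
  have hy2 : min (Metric.infDist y D) ρ ≤ ρ := min_le_right _ _
  unfold collar
  set a := min (Metric.infDist x D) ρ
  set b := min (Metric.infDist y D) ρ
  rw [Real.dist_eq, show (ρ ^ 2 - a ^ 2) / (2 * ρ) - (ρ ^ 2 - b ^ 2) / (2 * ρ)
    = (b - a) * ((a + b) / (2 * ρ)) by field_simp; ring, abs_mul, abs_sub_comm]
  have : |(a + b) / (2 * ρ)| ≤ 1 := by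
    rw [abs_of_nonneg (by positivity), div_le_one (by positivity)]
    linarith
  calc |a - b| * |(a + b) / (2 * ρ)| ≤ dist x y * 1 := by gcongr
    _ = _ := by simp

/-- The collar is the maximum of zero and the supremum of these paraboloids. They serve as
supporting functions from below in the two lemmas on derivatives. -/
lemma le_collar (hρ : 0 < ρ) {c : X} (hc : c ∈ D) (y : X) :
    (ρ ^ 2 - ‖y - c‖ ^ 2) / (2 * ρ) ≤ collar D ρ y := by
  unfold collar
  gcongr
  · exact le_min Metric.infDist_nonneg hρ.le
  · exact (min_le_left _ _).trans ((Metric.infDist_le_dist_of_mem hc).trans_eq (dist_eq_norm _ _))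

variable [InnerProductSpace ℝ X]

/-- The difference quotients of second order of `collar D ρ` are bounded below. -/
lemma collar_add_collar_sub_ge (hρ : 0 < ρ) (hD : D.Nonempty) (x h : X) :
    2 * collar D ρ x - ρ⁻¹ * ‖h‖ ^ 2 ≤ collar D ρ (x + h) + collar D ρ (x - h) := by
  by_cases hx : ρ ≤ Metric.infDist x D
  · have : collar D ρ x = 0 := by simp [collar, min_eq_right hx]
    have h1 := collar_nonneg (D := D) hρ (x + h)
    have h2 := collar_nonneg (D := D) hρ (x - h)
    have : 0 ≤ ρ⁻¹ * ‖h‖ ^ 2 := by positivity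
    linarith
  · push Not at hx
    have key : ∀ c ∈ D, 2 * ((ρ ^ 2 - dist x c ^ 2) / (2 * ρ)) - ρ⁻¹ * ‖h‖ ^ 2 ≤
        collar D ρ (x + h) + collar D ρ (x - h) := by
      intro c hc
      have h1 := le_collar hρ hc (x + h)
      have h2 := le_collar hρ hc (x - h)
      have h3 : ‖x + h - c‖ ^ 2 + ‖x - h - c‖ ^ 2 = 2 * (dist x c ^ 2 + ‖h‖ ^ 2) := by
        have := parallelogram_law_with_norm ℝ (x - c) h
        rw [dist_eq_norm, show x + h - c = x - c + h by abel, show x - h - c = x - c - h by abel]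
        linarith
      refine le_trans (le_of_eq ?_) (add_le_add h1 h2)
      rw [← add_div, show ρ ^ 2 - ‖x + h - c‖ ^ 2 + (ρ ^ 2 - ‖x - h - c‖ ^ 2) =
        2 * ρ ^ 2 - 2 * (dist x c ^ 2 + ‖h‖ ^ 2) by rw [← h3]; ring]
      field_simp
      ring
    have hlim : ContinuousAt
        (fun s : ℝ => 2 * ((ρ ^ 2 - s ^ 2) / (2 * ρ)) - ρ⁻¹ * ‖h‖ ^ 2) (Metric.infDist x D) := by
      fun_prop
    rw [collar, min_eq_left hx.le]
    -- The distance to `D` need not be attained here, so `s` decreases to it and each `s` is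
    -- undercut by some centre.
    refine le_of_tendsto (hlim.tendsto.mono_left (nhdsWithin_le_nhds (s := Set.Ioi (Metric.infDist x D)))) ?_
    filter_upwards [self_mem_nhdsWithin] with s hs
    obtain ⟨c, hc, hcs⟩ := (Metric.infDist_lt_iff hD).1 hs
    refine le_trans ?_ (key c hc)
    gcongr

variable [CompleteSpace X]

/-- A zero of a nonnegative function is a minimum, and the gradient takes the value zero by
convention where differentiability fails. -/
lemma gradient_collar_eq_zero (hρ : 0 < ρ) {x : X} (h : collar D ρ x = 0) :
    gradient (collar D ρ) x = 0 := by
  have : IsLocalMin (collar D ρ) x := by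
    apply Eventually.of_forall
    intro y
    rw [h]; exact collar_nonneg hρ y
  simp [gradient, this.fderiv_eq_zero]

/-- The paraboloid of a nearest centre touches the collar from below at `x`, so both have the same
gradient there. Close to the solid the gradient thus has norm nearly one. -/
lemma norm_gradient_collar_sq [FiniteDimensional ℝ X] (hρ : 0 < ρ) (hD : D.Nonempty)
    (hDc : IsClosed D) {x : X} (h : 0 < collar D ρ x)
    (hd : DifferentiableAt ℝ (collar D ρ) x) :
    ‖gradient (collar D ρ) x‖ ^ 2 = 1 - 2 * collar D ρ x / ρ := by
  obtain ⟨c, hc, hxc⟩ := hDc.exists_infDist_eq_dist hD x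
  have hlt := infDist_lt_of_collar_pos h
  have hval : collar D ρ x = (ρ ^ 2 - ‖x - c‖ ^ 2) / (2 * ρ) := by
    rw [collar, min_eq_left hlt.le, hxc, dist_eq_norm]
  have hq : HasFDerivAt (fun y : X => (ρ ^ 2 - ‖y - c‖ ^ 2) / (2 * ρ))
      (-(ρ⁻¹ • innerSL ℝ (x - c))) x := by
    have h1 := ((((hasFDerivAt_id x).sub_const c).norm_sq).const_sub (ρ ^ 2)).mul_const (2 * ρ)⁻¹
    refine h1.congr_fderiv ?_
    ext v
    simp
    field_simp
  have hmin : IsLocalMin (fun y => collar D ρ y - (ρ ^ 2 - ‖y - c‖ ^ 2) / (2 * ρ)) x := by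
    apply Eventually.of_forall
    intro y
    simp only
    rw [← hval, sub_self, sub_nonneg]
    exact le_collar hρ hc y
  have hz := hmin.hasFDerivAt_eq_zero (hd.hasFDerivAt.sub hq)
  have hfd : fderiv ℝ (collar D ρ) x = -(ρ⁻¹ • innerSL ℝ (x - c)) := sub_eq_zero.1 hz
  have : ‖gradient (collar D ρ) x‖ = ρ⁻¹ * ‖x - c‖ := by
    rw [gradient, LinearIsometryEquiv.norm_map, hfd, norm_neg, norm_smul, innerSL_apply_norm,
      Real.norm_of_nonneg (by positivity)]
  rw [this, hval]
  field_simp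
  ring

end Collar

/-! ### Semiconvexity as a lower bound for the distributional Laplacian -/

section Semiconvex

variable {n : ℕ} {W ψ : E n → ℝ} {κ : ℝ} {C D : NNReal}

lemma inner_gradient_eq_lineDeriv {f : E n → ℝ} {x : E n} (hf : DifferentiableAt ℝ f x) (v : E n) :
    inner ℝ (gradient f x) v = lineDeriv ℝ f x v := by
  rw [hf.lineDeriv_eq_fderiv, gradient, InnerProductSpace.toDual_symm_apply]

lemma measurable_gradient (f : E n → ℝ) : Measurable (gradient f) :=
  (LinearIsometryEquiv.continuous _).measurable.comp (measurable_fderiv ℝ f)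

lemma norm_gradient_le {f : E n → ℝ} (hf : LipschitzWith C f) (x : E n) : ‖gradient f x‖ ≤ C := by
  rw [gradient, LinearIsometryEquiv.norm_map]
  exact norm_fderiv_le_of_lipschitz ℝ hf

lemma gradient_eq_zero_of_notMem_tsupport {f : E n → ℝ} {x : E n} (hx : x ∉ tsupport f) :
    gradient f x = 0 := by
  have : f =ᶠ[𝓝 x] fun _ => 0 := notMem_tsupport_iff_eventuallyEq.1 hx
  simp [gradient, this.fderiv_eq]

lemma memLp_of_bounded_of_isCompact {F : Type*} [NormedAddCommGroup F] {f : E n → F}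
    (hf : AEStronglyMeasurable f volume) {K : Set (E n)} (hK : IsCompact K)
    (h0 : ∀ x ∉ K, f x = 0) {c : ℝ} (hc : ∀ x, ‖f x‖ ≤ c) (p : ENNReal) : MemLp f p volume := by
  have hfK : f = K.indicator f := by
    ext x
    by_cases hx : x ∈ K <;> simp [hx, h0]
  rw [hfK, memLp_indicator_iff_restrict hK.measurableSet]
  have : IsFiniteMeasure (volume.restrict K) := isFiniteMeasure_restrict.2 hK.measure_lt_top.ne
  exact MemLp.of_bound hf.restrict c (Eventually.of_forall hc)

/-- Summation by parts for difference quotients: translation invariance turns the product of two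
first differences into a second difference of `W` times `ψ`. The limit `t → 0` is taken by dominated
convergence, the Lipschitz bounds giving the majorant and Rademacher's theorem the pointwise limit.
-/
lemma integral_lineDeriv_mul_lineDeriv_le (hW : LipschitzWith C W) (hψ : LipschitzWith D ψ)
    (hψc : HasCompactSupport ψ) (hψ0 : 0 ≤ ψ) (v : E n)
    (hconv : ∀ x h, 2 * W x - κ * ‖h‖ ^ 2 ≤ W (x + h) + W (x - h)) :
    ∫ x, lineDeriv ℝ W x v * lineDeriv ℝ ψ x v ≤ κ * ‖v‖ ^ 2 * ∫ x, ψ x := by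
  set K := Metric.cthickening ‖v‖ (tsupport ψ) with hK
  have K_compact : IsCompact K := IsCompact.cthickening hψc
  have hlim : Tendsto (fun t : ℝ => ∫ x, (t⁻¹ • (W (x + t • v) - W x)) *
      (t⁻¹ • (ψ (x + t • v) - ψ x))) (𝓝[>] 0)
      (𝓝 (∫ x, lineDeriv ℝ W x v * lineDeriv ℝ ψ x v)) := by
    apply tendsto_integral_filter_of_dominated_convergence
      (K.indicator (fun _ ↦ (C * ‖v‖) * (D * ‖v‖)))
    · filter_upwards with t
      have := hW.continuous
      have := hψ.continuous
      exact Continuous.aestronglyMeasurable (by fun_prop)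
    · filter_upwards [Ioc_mem_nhdsGT zero_lt_one] with t ht
      have t_pos : 0 < t := ht.1
      have hq : ∀ {f : E n → ℝ} {c : NNReal}, LipschitzWith c f → ∀ x,
          ‖t⁻¹ • (f (x + t • v) - f x)‖ ≤ c * ‖v‖ := by
        intro f c hf x
        have := hf.norm_sub_le (x + t • v) x
        rw [norm_smul, norm_inv, Real.norm_of_nonneg t_pos.le, inv_mul_le_iff₀ t_pos]
        refine this.trans_eq ?_
        rw [add_sub_cancel_left, norm_smul, Real.norm_of_nonneg t_pos.le]
        ring
      filter_upwards with x
      by_cases hx : x ∈ K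
      · rw [Set.indicator_of_mem hx, norm_mul]
        exact mul_le_mul (hq hW x) (hq hψ x) (norm_nonneg _) (by positivity)
      · have A : ψ x = 0 := by
          rw [← Function.notMem_support]
          contrapose hx
          exact Metric.self_subset_cthickening _ (subset_tsupport _ hx)
        have B : ψ (x + t • v) = 0 := by
          rw [← Function.notMem_support]
          contrapose hx
          apply Metric.mem_cthickening_of_dist_le _ _ (‖v‖) (tsupport ψ) (subset_tsupport _ hx)
          simp only [dist_eq_norm, sub_add_cancel_left, norm_neg, norm_smul, Real.norm_eq_abs,
            abs_of_nonneg t_pos.le]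
          exact mul_le_of_le_one_left (norm_nonneg v) ht.2
        simp [A, B, hx]
    · rw [integrable_indicator_iff K_compact.measurableSet]
      exact ContinuousOn.integrableOn_compact K_compact (by fun_prop)
    · filter_upwards [hW.ae_lineDifferentiableAt v, hψ.ae_lineDifferentiableAt v] with x hx hx'
      exact hx.hasLineDerivAt.tendsto_slope_zero_right.mul
        hx'.hasLineDerivAt.tendsto_slope_zero_right
  refine le_of_tendsto hlim ?_
  filter_upwards [self_mem_nhdsWithin] with t (ht : 0 < t)
  have hWc := hW.continuous
  have hψct := hψ.continuous
  have int1 : ∀ (g : E n → ℝ), Continuous g → Integrable (fun x => g x * ψ x) := fun g hg =>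
    (hg.mul hψct).integrable_of_hasCompactSupport hψc.mul_left
  have int2 : ∀ (g : E n → ℝ), Continuous g → Integrable (fun x => g x * ψ (x + t • v)) := by
    intro g hg
    apply Continuous.integrable_of_hasCompactSupport (by fun_prop)
    exact (hψc.comp_homeomorph (Homeomorph.addRight (t • v))).mul_left
  have e1 : ∫ x, (W (x + t • v) - W x) * ψ (x + t • v) = ∫ x, (W x - W (x - t • v)) * ψ x := by
    rw [← integral_add_right_eq_self (fun x => (W x - W (x - t • v)) * ψ x) (t • v)]
    simp
  have e2 : ∫ x, (W (x + t • v) - W x) * (ψ (x + t • v) - ψ x) =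
      ∫ x, (2 * W x - (W (x + t • v) + W (x - t • v))) * ψ x := by
    have i1 := int2 (fun x => W (x + t • v) - W x) (by fun_prop)
    have i2 := int1 (fun x => W (x + t • v) - W x) (by fun_prop)
    have i3 := int1 (fun x => W x - W (x - t • v)) (by fun_prop)
    calc _ = ∫ x, ((W (x + t • v) - W x) * ψ (x + t • v) - (W (x + t • v) - W x) * ψ x) := by
          congr 1; ext x; ring
      _ = (∫ x, (W x - W (x - t • v)) * ψ x) - ∫ x, (W (x + t • v) - W x) * ψ x := by
          rw [integral_sub i1 i2, e1]
      _ = _ := by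
          rw [← integral_sub i3 i2]
          congr 1; ext x; ring
  calc ∫ x, (t⁻¹ • (W (x + t • v) - W x)) * (t⁻¹ • (ψ (x + t • v) - ψ x))
      = (t⁻¹) ^ 2 * ∫ x, (W (x + t • v) - W x) * (ψ (x + t • v) - ψ x) := by
        rw [← integral_const_mul]
        congr 1; ext x; simp; ring
    _ ≤ (t⁻¹) ^ 2 * ∫ x, (κ * ‖t • v‖ ^ 2) * ψ x := by
        rw [e2]
        gcongr
        · exact int1 _ (by fun_prop)
        · exact int1 (fun _ => (κ * ‖t • v‖ ^ 2)) (by fun_prop)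
        · intro x
          apply mul_le_mul_of_nonneg_right _ (hψ0 x)
          linarith [hconv x (t • v)]
    _ = _ := by
        rw [integral_const_mul, norm_smul, Real.norm_of_nonneg ht.le]
        field_simp

/-- If the second order difference quotients of `W` are at least `-κ`, then `ΔW ≥ -nκ` in the
sense of distributions. -/
theorem integral_inner_gradient_le (hW : LipschitzWith C W) (hψ : LipschitzWith D ψ)
    (hψc : HasCompactSupport ψ) (hψ0 : 0 ≤ ψ)
    (hconv : ∀ x h, 2 * W x - κ * ‖h‖ ^ 2 ≤ W (x + h) + W (x - h)) :
    ∫ x, inner ℝ (gradient W x) (gradient ψ x) ≤ n * κ * ∫ x, ψ x := by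
  let b := EuclideanSpace.basisFun (Fin n) ℝ
  have hsum : (fun x => inner ℝ (gradient W x) (gradient ψ x)) =ᵐ[volume]
      fun x => ∑ i, lineDeriv ℝ W x (b i) * lineDeriv ℝ ψ x (b i) := by
    filter_upwards [hW.ae_differentiableAt, hψ.ae_differentiableAt] with x h1 h2
    rw [← b.sum_inner_mul_inner]
    refine Finset.sum_congr rfl fun i _ => ?_
    rw [inner_gradient_eq_lineDeriv h1, real_inner_comm, inner_gradient_eq_lineDeriv h2]
  have hint : ∀ i, Integrable fun x => lineDeriv ℝ W x (b i) * lineDeriv ℝ ψ x (b i) := by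
    intro i
    have h2 : Integrable fun x => lineDeriv ℝ ψ x (b i) := by
      refine memLp_one_iff_integrable.1 (memLp_of_bounded_of_isCompact
        (measurable_lineDeriv hψ.continuous).aestronglyMeasurable hψc.isCompact
        (fun x hx => ?_) (fun x => norm_lineDeriv_le_of_lipschitz ℝ hψ) 1)
      have : ψ =ᶠ[𝓝 x] 0 := notMem_tsupport_iff_eventuallyEq.1 hx
      simp only [this.lineDeriv_eq]
      simp [lineDeriv]
    exact h2.bdd_mul (c := C * ‖b i‖) (measurable_lineDeriv hW.continuous).aestronglyMeasurable
      (Eventually.of_forall fun x => norm_lineDeriv_le_of_lipschitz ℝ hW)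
  rw [integral_congr_ae hsum, integral_finsetSum _ fun i _ => hint i]
  calc _ ≤ ∑ i : Fin n, κ * ‖b i‖ ^ 2 * ∫ x, ψ x := Finset.sum_le_sum fun i _ =>
        integral_lineDeriv_mul_lineDeriv_le hW hψ hψc hψ0 (b i) hconv
    _ = _ := by simp [mul_assoc]

end Semiconvex

/-! ### Surface measure against the volume of thin layers -/

section Hausdorff

/-- The centres of the open balls of radius `ρ` that do not meet `M`. -/
def ballCenters {X : Type*} [PseudoMetricSpace X] (M : Set X) (ρ : ℝ) : Set X :=
  {c | ∀ x ∈ M, ρ ≤ dist x c}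

lemma isClosed_ballCenters {X : Type*} [PseudoMetricSpace X] (M : Set X) (ρ : ℝ) :
    IsClosed (ballCenters M ρ) := by
  simp only [ballCenters, Set.ofPred_forall]
  exact isClosed_biInter fun x _ => isClosed_le continuous_const (by fun_prop)

variable {n : ℕ} {M S : Set (E n)} {ρ : ℝ}

/-- Such a point lies inside an open ball that misses `M`. -/
lemma notMem_closure_of_collar_pos (hD : (ballCenters M ρ).Nonempty) {x : E n}
    (h : 0 < collar (ballCenters M ρ) ρ x) : x ∉ closure M := by
  obtain ⟨c, hc, hxc⟩ := (Metric.infDist_lt_iff hD).1 (infDist_lt_of_collar_pos h)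
  intro hx
  obtain ⟨y, hy, hyM⟩ := mem_closure_iff.1 hx (Metric.ball c ρ) Metric.isOpen_ball hxc
  exact absurd (hc y hyM) (not_le.2 hy)

/-- Part of the fluid close to the boundary of `M`. -/
def collarLayer (M : Set (E n)) (ρ t : ℝ) : Set (E n) :=
  {x | 0 < collar (ballCenters M ρ) ρ x ∧ collar (ballCenters M ρ) ρ x < t}

lemma isOpen_collarLayer (hρ : 0 < ρ) (t : ℝ) : IsOpen (collarLayer M ρ t) :=
  (isOpen_lt continuous_const (lipschitzWith_collar hρ).continuous).inter
    (isOpen_lt (lipschitzWith_collar hρ).continuous continuous_const)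

/-- The normalized volume of the layer of thickness `1 / (k + 1)`. -/
def layerMeasure (M : Set (E n)) (ρ : ℝ) (k : ℕ) : Measure (E n) :=
  ENNReal.ofReal (k + 1) • volume.restrict (collarLayer M ρ (1 / (k + 1)))

/-- A ball of radius proportional to `t` close to `p` lies in the layer of thickness `t`. -/
lemma exists_ball_subset_collarLayer (hρ : 0 < ρ) {p : E n} (hp : p ∈ closure M)
    (hpc : ∃ c ∈ ballCenters M ρ, dist c p = ρ) {t : ℝ} (ht : 0 < t) (htρ : t ≤ ρ) :
    ∃ y, Metric.ball y (t / 4) ⊆ collarLayer M ρ t ∩ Metric.ball p (t / 2) := by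
  obtain ⟨c, hc, hcp⟩ := hpc
  have hp0 : collar (ballCenters M ρ) ρ p = 0 := by
    by_contra h
    exact notMem_closure_of_collar_pos ⟨c, hc⟩ ((collar_nonneg hρ p).lt_of_ne' h) hp
  have hcp' : ‖c - p‖ = ρ := by rw [← dist_eq_norm, hcp]
  -- Move from `p` by `t / 4` towards the centre of the touching ball. Points closer than `t / 4` to
  -- the new point lie in that ball, where the collar is positive, and within `t / 2` of `p`, where
  -- it is less than `t` because it vanishes at `p` and is 1-Lipschitz.
  refine ⟨p + (t / 4 / ρ) • (c - p), fun x hx => ?_⟩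
  rw [Metric.mem_ball, dist_eq_norm] at hx
  have h1 : ‖x - p‖ < t / 2 := by
    have : ‖(t / 4 / ρ) • (c - p)‖ = t / 4 := by
      rw [norm_smul, hcp', Real.norm_of_nonneg (by positivity)]; field_simp
    calc ‖x - p‖ = ‖(x - (p + (t / 4 / ρ) • (c - p))) + (t / 4 / ρ) • (c - p)‖ := by congr 1; abel
      _ ≤ _ := norm_add_le _ _
      _ < _ := by rw [this]; linarith
  have h2 : ‖x - c‖ < ρ := by
    have : ‖(1 - t / 4 / ρ) • (p - c)‖ = ρ - t / 4 := by
      have : t / 4 / ρ ≤ 1 := by rw [div_le_one hρ]; linarith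
      rw [norm_smul, norm_sub_rev p, hcp', Real.norm_of_nonneg (by linarith)]; field_simp
    calc ‖x - c‖ = ‖(x - (p + (t / 4 / ρ) • (c - p))) + (1 - t / 4 / ρ) • (p - c)‖ := by
          congr 1; module
      _ ≤ _ := norm_add_le _ _
      _ < _ := by rw [this]; linarith
  refine ⟨⟨?_, ?_⟩, by rwa [Metric.mem_ball, dist_eq_norm]⟩
  · refine lt_of_lt_of_le ?_ (le_collar hρ hc x)
    apply div_pos _ (by positivity)
    nlinarith [norm_nonneg (x - c)]
  · have := (lipschitzWith_collar (D := ballCenters M ρ) hρ).dist_le_mul x p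
    rw [hp0, Real.dist_eq, sub_zero, dist_eq_norm] at this
    have := (le_abs_self _).trans this
    simp at this
    linarith

/-- Constant in the comparison of the surface measure with the volume of layers. -/
def layerConst (n : ℕ) : ENNReal :=
  (Measure.addHaarScalarFactor (volume : Measure (EuclideanSpace ℝ (Fin (n - 1))))
    μH[((n - 1 : ℕ) : ℝ)] : ENNReal) *
    (ENNReal.ofReal (5 ^ (n - 1) * 4 ^ n) / volume (Metric.ball (0 : E n) 1))

lemma layerConst_ne_top (n : ℕ) : layerConst n ≠ ⊤ := by
  unfold layerConst
  refine ENNReal.mul_ne_top ENNReal.coe_ne_top (ENNReal.div_ne_top ENNReal.ofReal_ne_top ?_)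
  exact (Metric.measure_ball_pos _ _ one_pos).ne'

/-- Vitali: choose disjoint balls of radius `t / 2` centred on `A` whose fivefold enlargements cover
`A`. Each contains a ball of radius `t / 4` in the layer, so the Hausdorff sum of the cover is at
most a constant times the layer volume divided by `t`. The uniform radius `s` keeps the small balls
in `U`. -/
lemma surfaceMeasure_le_liminf_aux (hn : n ≠ 0) (hρ : 0 < ρ)
    {A U : Set (E n)} (hA : ∀ p ∈ A, p ∈ closure M ∧ ∃ c ∈ ballCenters M ρ, dist c p = ρ)
    {s : ℝ} (hs : 0 < s) (hAU : ∀ p ∈ A, Metric.ball p s ⊆ U) :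
    surfaceMeasure n A ≤ layerConst n * liminf (fun k => layerMeasure M ρ k U) atTop := by
  let t : ℕ → ℝ := fun k => 1 / (k + 1)
  have ht0 : ∀ k, 0 < t k := fun k => by positivity
  have htlim : Tendsto t atTop (𝓝 0) := tendsto_one_div_add_atTop_nhds_zero_nat
  choose u huA hudisj hucov using fun k => Vitali.exists_disjoint_subfamily_covering_enlargement_closedBall
    A id (fun _ => t k / 2) (t k / 2) (fun _ _ => le_rfl) 5 (by norm_num)
  have hcount : ∀ k, Countable (u k) := fun k =>
    ((hudisj k).countable_of_nonempty_interior fun p _ =>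
      ⟨p, mem_interior_iff_mem_nhds.2 (Metric.closedBall_mem_nhds _ (by have := ht0 k; positivity))⟩).to_subtype
  have hdiam : ∀ (p : E n) (r : ℝ),
      Metric.ediam (Metric.closedBall p (5 * (r / 2))) ≤ ENNReal.ofReal (5 * r) := by
    intro p r
    refine Metric.ediam_le fun x hx y hy => ?_
    rw [edist_dist]
    apply ENNReal.ofReal_le_ofReal
    have := dist_triangle_right x y p
    rw [Metric.mem_closedBall] at hx hy
    linarith
  have hH := Measure.hausdorffMeasure_le_liminf_tsum (β := ℕ) (ι := fun k => u k)
    ((n - 1 : ℕ) : ℝ) A (l := atTop) (fun k => ENNReal.ofReal (5 * t k))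
    (by
      have := ENNReal.tendsto_ofReal (htlim.const_mul 5)
      simpa using this)
    (fun k p => Metric.closedBall (p : E n) (5 * (t k / 2)))
    (Eventually.of_forall fun k p => hdiam p (t k))
    (Eventually.of_forall fun k p hp => by
      obtain ⟨b, hb, hsub⟩ := hucov k p hp
      refine Set.mem_iUnion.2 ⟨⟨b, hb⟩, hsub (Metric.mem_closedBall_self ?_)⟩
      have := ht0 k; positivity)
  rw [surfaceMeasure, Measure.euclideanHausdorffMeasure_def, Measure.smul_apply, layerConst,
    ENNReal.smul_def, smul_eq_mul, mul_assoc]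
  gcongr
  refine hH.trans ?_
  rw [← ENNReal.liminf_const_mul_of_ne_top]
  · refine liminf_le_liminf ?_
    have ev : ∀ᶠ k in atTop, t k ≤ min ρ s :=
      (htlim.eventually (ge_mem_nhds (lt_min hρ hs)))
    filter_upwards [ev] with k hk
    choose! y hy using fun p (hp : p ∈ A) => exists_ball_subset_collarLayer hρ (hA p hp).1 (hA p hp).2 (ht0 k)
      (hk.trans (min_le_left _ _))
    -- Since `k + 1 = 1 / t`, this is `(5t)^(n-1) = 5^(n-1) 4^n (t/4)^n / t`, which explains
    -- `layerConst`.
    have hvol : ∀ p : u k, Metric.ediam (Metric.closedBall (p : E n) (5 * (t k / 2))) ^ ((n - 1 : ℕ) : ℝ) ≤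
        (ENNReal.ofReal (5 ^ (n - 1) * 4 ^ n) / volume (Metric.ball (0 : E n) 1)) *
         (ENNReal.ofReal (k + 1) * volume (Metric.ball (y p) (t k / 4))) := by
      intro p
      refine (ENNReal.rpow_le_rpow (hdiam p (t k)) (by positivity)).trans ?_
      have hV0 : volume (Metric.ball (0 : E n) 1) ≠ 0 := (Metric.measure_ball_pos _ _ one_pos).ne'
      have hV1 : volume (Metric.ball (0 : E n) 1) ≠ ⊤ := measure_ball_lt_top.ne
      have h0 := ht0 k
      rw [Measure.addHaar_ball_of_pos _ (y p) (show 0 < t k / 4 by positivity), finrank_euclideanSpace_fin, ENNReal.rpow_natCast,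
        ← ENNReal.ofReal_pow (by positivity), ENNReal.div_eq_inv_mul, ← mul_assoc (ENNReal.ofReal _)
        (ENNReal.ofReal _), ← ENNReal.ofReal_mul (by positivity), mul_comm _ (volume _),
        mul_mul_mul_comm, ENNReal.inv_mul_cancel hV0 hV1, one_mul,
        ← ENNReal.ofReal_mul (by positivity)]
      apply ENNReal.ofReal_le_ofReal
      obtain ⟨m, rfl⟩ := Nat.exists_eq_succ_of_ne_zero hn
      have : t k * (k + 1) = 1 := by simp only [t]; field_simp
      refine le_of_eq ?_
      calc (5 * t k) ^ (m + 1 - 1) = 5 ^ m * t k ^ m * (t k * (k + 1)) := by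
            rw [this, mul_pow]; simp
        _ = 5 ^ m * (4 ^ (m + 1) * (t k / 4) ^ (m + 1)) * (k + 1) := by
            rw [← mul_pow 4, show 4 * (t k / 4) = t k by ring]; ring
        _ = _ := by simp only [Nat.succ_eq_add_one, Nat.add_sub_cancel]; ring
    refine (ENNReal.tsum_le_tsum hvol).trans ?_
    rw [ENNReal.tsum_mul_left, ENNReal.tsum_mul_left, layerMeasure, Measure.smul_apply, smul_eq_mul]
    gcongr
    rw [← measure_iUnion]
    · rw [Measure.restrict_apply' (isOpen_collarLayer hρ _).measurableSet]
      apply measure_mono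
      apply Set.iUnion_subset
      intro p x hx
      have := hy p (huA k p.2) hx
      refine ⟨hAU p (huA k p.2) (Metric.ball_subset_ball ?_ this.2), this.1⟩
      have := hk.trans (min_le_right _ _)
      linarith [ht0 k]
    · intro p q hpq
      have := hudisj k p.2 q.2 (fun h => hpq (Subtype.ext h))
      refine Disjoint.mono ?_ ?_ this
      · exact fun x hx => Metric.ball_subset_closedBall (hy p (huA k p.2) hx).2
      · exact fun x hx => Metric.ball_subset_closedBall (hy q (huA k q.2) hx).2
    · exact fun p => Metric.isOpen_ball.measurableSet
  · exact ENNReal.div_ne_top ENNReal.ofReal_ne_top (Metric.measure_ball_pos _ _ one_pos).ne'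

/-- The points of `S` around which a ball of radius `1 / (m + 1)` stays in `U` increase to `S ∩ U`
with `m`, and the preceding bound does not depend on that radius. -/
theorem surfaceMeasure_inter_le_liminf (hn : n ≠ 0) (hρ : 0 < ρ)
    (hS : ∀ p ∈ S, p ∈ closure M ∧ ∃ c ∈ ballCenters M ρ, dist c p = ρ)
    {U : Set (E n)} (hU : IsOpen U) :
    surfaceMeasure n (S ∩ U) ≤ layerConst n * liminf (fun k => layerMeasure M ρ k U) atTop := by
  let A : ℕ → Set (E n) := fun m => {p ∈ S | Metric.ball p (1 / (m + 1)) ⊆ U}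
  have hmono : Monotone A := by
    intro m m' h p hp
    refine ⟨hp.1, (Metric.ball_subset_ball ?_).trans hp.2⟩
    exact one_div_le_one_div_of_le (by positivity) (by gcongr)
  have hsub : S ∩ U ⊆ ⋃ m, A m := by
    rintro p ⟨hpS, hpU⟩
    obtain ⟨s, hs, hsU⟩ := Metric.isOpen_iff.1 hU p hpU
    obtain ⟨m, hm⟩ := exists_nat_one_div_lt hs
    exact Set.mem_iUnion.2 ⟨m, hpS, (Metric.ball_subset_ball hm.le).trans hsU⟩
  refine (measure_mono hsub).trans ?_
  rw [hmono.measure_iUnion]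
  exact iSup_le fun m => surfaceMeasure_le_liminf_aux hn hρ (fun p hp => hS p hp.1)
    (by positivity) (fun p hp => hp.2)

/-- The half of the portmanteau theorem that starts from lower bounds on open sets; it passes from
open sets to continuous nonnegative functions. -/
theorem lintegral_surfaceMeasure_le_liminf (hn : n ≠ 0) (hρ : 0 < ρ)
    (hS : ∀ p ∈ S, p ∈ closure M ∧ ∃ c ∈ ballCenters M ρ, dist c p = ρ)
    {φ : E n → ℝ} (hφ : Continuous φ) (hφ0 : 0 ≤ φ) :
    ∫⁻ x in S, ENNReal.ofReal (φ x) ∂surfaceMeasure n ≤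
      layerConst n * liminf (fun k => ∫⁻ x, ENNReal.ofReal (φ x) ∂layerMeasure M ρ k) atTop := by
  have := lintegral_le_liminf_lintegral_of_forall_isOpen_measure_le_liminf_measure
    (μ := (surfaceMeasure n).restrict S) (μs := fun k => layerConst n • layerMeasure M ρ k)
    hφ hφ0 (fun U hU => by
      rw [Measure.restrict_apply hU.measurableSet, Set.inter_comm]
      refine (surfaceMeasure_inter_le_liminf hn hρ hS hU).trans_eq ?_
      simp only [Measure.smul_apply, smul_eq_mul]
      rw [ENNReal.liminf_const_mul_of_ne_top (layerConst_ne_top n)])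
  refine this.trans_eq ?_
  simp only [lintegral_smul_measure, smul_eq_mul]
  rw [ENNReal.liminf_const_mul_of_ne_top (layerConst_ne_top n)]

end Hausdorff

/-! ### The one-sided trace inequality -/

section Trace

variable {n : ℕ} {M S : Set (E n)} {ρ : ℝ}

/-- The product of two bounded Lipschitz functions is Lipschitz. -/
lemma LipschitzWith.exists_mul_of_bounded {X : Type*} [PseudoMetricSpace X] {f g : X → ℝ}
    {C D : NNReal} (hf : LipschitzWith C f) (hg : LipschitzWith D g) {a b : ℝ}
    (ha : ∀ x, |f x| ≤ a) (hb : ∀ x, |g x| ≤ b) : ∃ K, LipschitzWith K fun x => f x * g x := by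
  refine ⟨(a * D + b * C).toNNReal, LipschitzWith.of_dist_le_mul fun x y => ?_⟩
  have ha0 : 0 ≤ a := (abs_nonneg _).trans (ha x)
  have hb0 : 0 ≤ b := (abs_nonneg _).trans (hb x)
  rw [Real.coe_toNNReal _ (by positivity), Real.dist_eq,
    show f x * g x - f y * g y = f x * (g x - g y) + g y * (f x - f y) by ring]
  refine (abs_add_le _ _).trans ?_
  rw [abs_mul, abs_mul, add_mul, mul_assoc, mul_assoc]
  have h1 := hf.dist_le_mul x y
  have h2 := hg.dist_le_mul x y
  rw [Real.dist_eq] at h1 h2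
  gcongr
  exacts [ha x, hb y]

lemma HasCompactSupport.exists_abs_le {φ : E n → ℝ} (hφ : Continuous φ)
    (hc : HasCompactSupport φ) : ∃ b, ∀ x, |φ x| ≤ b := by
  obtain ⟨b, hb⟩ := hφ.bounded_above_of_compact_support hc
  exact ⟨b, hb⟩

lemma lipschitzWith_div_add {t : ℝ} (ht : 0 < t) {W : E n → ℝ} (hW0 : 0 ≤ W)
    (hW : LipschitzWith 1 W) : LipschitzWith (t⁻¹).toNNReal fun x => W x / (W x + t) := by
  apply LipschitzWith.of_dist_le_mul
  intro x y
  have hx := hW0 x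
  have hy := hW0 y
  simp only [Pi.zero_apply] at hx hy
  have h := hW.dist_le_mul x y
  rw [Real.coe_toNNReal _ (by positivity), Real.dist_eq]
  rw [Real.dist_eq] at h
  have : W x / (W x + t) - W y / (W y + t) = (t / ((W x + t) * (W y + t))) * (W x - W y) := by
    field_simp
    ring
  rw [this, abs_mul]
  have h2 : |t / ((W x + t) * (W y + t))| ≤ t⁻¹ := by
    rw [abs_of_nonneg (by positivity), div_le_iff₀ (by positivity), inv_mul_eq_div,
      le_div_iff₀ ht]
    nlinarith [mul_nonneg hx hy]
  simp only [NNReal.coe_one, one_mul] at h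
  gcongr

/-- With `η(s) = s / (s + t)`, the term in `η'(W) |∇W|²` concentrates on the layer of thickness `t`
and yields the surface integral; the other term becomes the volume integral as `t → 0`. -/
lemma inner_gradient_gradient_div_add_mul {t : ℝ} (ht : 0 < t) {W φ : E n → ℝ} (hW0 : 0 ≤ W)
    {x : E n} (hW : DifferentiableAt ℝ W x) (hφ : DifferentiableAt ℝ φ x) :
    inner ℝ (gradient W x) (gradient (fun x => W x / (W x + t) * φ x) x) =
      W x / (W x + t) * inner ℝ (gradient W x) (gradient φ x) +
        t / (W x + t) ^ 2 * φ x * ‖gradient W x‖ ^ 2 := by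
  have hx : 0 < W x + t := add_pos_of_nonneg_of_pos (hW0 x) ht
  have hη : HasDerivAt (fun s : ℝ => s / (s + t)) (t / (W x + t) ^ 2) (W x) := by
    have := (hasDerivAt_id (W x)).div ((hasDerivAt_id (W x)).add_const t) hx.ne'
    convert! this using 1
    simp
  have h1 := (hη.comp_hasFDerivAt x hW.hasFDerivAt).mul hφ.hasFDerivAt
  have h2 : ∀ v, fderiv ℝ (fun x => W x / (W x + t) * φ x) x v =
      W x / (W x + t) * fderiv ℝ φ x v + φ x * (t / (W x + t) ^ 2 * fderiv ℝ W x v) := by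
    intro v
    have := h1.fderiv
    simp only [Function.comp_def] at this
    erw [this]
    simp
  have h3 : ∀ f : E n → ℝ, ∀ v, inner ℝ v (gradient f x) = fderiv ℝ f x v := by
    intro f v
    rw [real_inner_comm, gradient, InnerProductSpace.toDual_symm_apply]
  rw [h3, h2, h3 φ, ← h3 W, real_inner_self_eq_norm_sq]
  ring

/-- Trace inequality: the integral over the boundary is bounded by an integral over the fluid,
where the collar function plays the role of a distance function. -/
theorem lintegral_surfaceMeasure_le_collar (hn : n ≠ 0) (hρ : 0 < ρ)
    (hD : (ballCenters M ρ).Nonempty)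
    (hS : ∀ p ∈ S, p ∈ closure M ∧ ∃ c ∈ ballCenters M ρ, dist c p = ρ)
    {φ : E n → ℝ} {L : NNReal} (hφ : LipschitzWith L φ) (hφc : HasCompactSupport φ)
    (hφ0 : 0 ≤ φ) :
    0 ≤ ∫ x in {x | 0 < collar (ballCenters M ρ) ρ x},
      (n * ρ⁻¹ * φ x - inner ℝ (gradient (collar (ballCenters M ρ) ρ) x) (gradient φ x)) ∧
    ∫⁻ x in S, ENNReal.ofReal (φ x) ∂surfaceMeasure n ≤
      layerConst n * ENNReal.ofReal (8 * ∫ x in {x | 0 < collar (ballCenters M ρ) ρ x},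
        (n * ρ⁻¹ * φ x - inner ℝ (gradient (collar (ballCenters M ρ) ρ) x) (gradient φ x))) := by
  set W := collar (ballCenters M ρ) ρ
  have hW0 : 0 ≤ W := fun x => collar_nonneg hρ x
  have hW : LipschitzWith 1 W := lipschitzWith_collar hρ
  let f : E n → ℝ := fun x => n * ρ⁻¹ * φ x - inner ℝ (gradient W x) (gradient φ x)
  have hinner_meas : Measurable fun x => inner ℝ (gradient W x) (gradient φ x) :=
    (measurable_gradient W).inner (measurable_gradient φ)
  have hinner : Integrable fun x => inner ℝ (gradient W x) (gradient φ x) := by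
    refine memLp_one_iff_integrable.1 (memLp_of_bounded_of_isCompact
      hinner_meas.aestronglyMeasurable hφc.isCompact
      (fun x hx => by simp [gradient_eq_zero_of_notMem_tsupport hx]) (c := 1 * L) (fun x => ?_) 1)
    exact (norm_inner_le_norm _ _).trans
      (mul_le_mul (norm_gradient_le hW x) (norm_gradient_le hφ x) (norm_nonneg _) (by simp))
  have hφint : Integrable φ := hφ.continuous.integrable_of_hasCompactSupport hφc
  have hf : Integrable f := (hφint.const_mul _).sub hinner
  let t : ℕ → ℝ := fun k => 1 / (k + 1)
  have ht0 : ∀ k, 0 < t k := fun k => by positivity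
  have htlim : Tendsto t atTop (𝓝 0) := tendsto_one_div_add_atTop_nhds_zero_nat
  -- This cut-off vanishes where `W` does and increases to one on `{W > 0}` as `t k` tends to zero.
  let η : ℕ → E n → ℝ := fun k x => W x / (W x + t k)
  have hη0 : ∀ k x, 0 ≤ η k x := fun k x => by
    have h1 := hW0 x
    have := ht0 k
    simp only [Pi.zero_apply] at h1
    positivity
  have hη1 : ∀ k x, η k x ≤ 1 := fun k x => by
    have h1 := hW0 x
    have := ht0 k
    simp only [Pi.zero_apply] at h1
    exact div_le_one_of_le₀ (by linarith) (by positivity)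
  have hηc : ∀ k, Continuous (η k) := fun k => (lipschitzWith_div_add (ht0 k) hW0 hW).continuous
  have hηf : ∀ k, Integrable fun x => η k x * f x := fun k =>
    hf.bdd_mul (c := 1) (hηc k).aestronglyMeasurable
      (Eventually.of_forall fun x => by rw [Real.norm_of_nonneg (hη0 k x)]; exact hη1 k x)
  have hlim : Tendsto (fun k => ∫ x, η k x * f x) atTop (𝓝 (∫ x in {x | 0 < W x}, f x)) := by
    rw [← integral_indicator (measurableSet_lt measurable_const hW.continuous.measurable)]
    refine tendsto_integral_of_dominated_convergence (fun x => ‖f x‖)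
      (fun k => (hηf k).aestronglyMeasurable) hf.norm (fun k => Eventually.of_forall fun x => ?_)
      (Eventually.of_forall fun x => ?_)
    · rw [norm_mul, Real.norm_of_nonneg (hη0 k x)]
      exact mul_le_of_le_one_left (norm_nonneg _) (hη1 k x)
    · rcases (hW0 x).eq_or_lt with h | h
      · simp only [Pi.zero_apply] at h
        simp [η, ← h]
      · have : Tendsto (fun k => η k x) atTop (𝓝 (W x / (W x + 0))) :=
          tendsto_const_nhds.div (tendsto_const_nhds.add htlim) (by simpa using h.ne')
        rw [add_zero, div_self h.ne'] at this
        have h' : x ∈ {x | 0 < W x} := h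
        simpa [h'] using this.mul_const (f x)
  obtain ⟨b, hb⟩ := HasCompactSupport.exists_abs_le hφ.continuous hφc
  have hweak : ∀ k, Integrable (fun x => t k / (W x + t k) ^ 2 * φ x * ‖gradient W x‖ ^ 2) ∧
      ∫ x, t k / (W x + t k) ^ 2 * φ x * ‖gradient W x‖ ^ 2 ≤ ∫ x, η k x * f x := by
    intro k
    obtain ⟨K, hK⟩ := LipschitzWith.exists_mul_of_bounded
      (lipschitzWith_div_add (ht0 k) hW0 hW) hφ
      (fun x => by rw [abs_of_nonneg (hη0 k x)]; exact hη1 k x) hb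
    have hψ := integral_inner_gradient_le (κ := ρ⁻¹) hW hK hφc.mul_left
      (fun x => mul_nonneg (hη0 k x) (hφ0 x)) (fun x h => collar_add_collar_sub_ge hρ hD x h)
    have hae : (fun x => inner ℝ (gradient W x) (gradient (fun x => W x / (W x + t k) * φ x) x))
        =ᵐ[volume] fun x => η k x * inner ℝ (gradient W x) (gradient φ x) +
          t k / (W x + t k) ^ 2 * φ x * ‖gradient W x‖ ^ 2 := by
      filter_upwards [hW.ae_differentiableAt, hφ.ae_differentiableAt] with x h1 h2
      exact inner_gradient_gradient_div_add_mul (ht0 k) hW0 h1 h2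
    have hi1 : Integrable fun x => η k x * inner ℝ (gradient W x) (gradient φ x) :=
      hinner.bdd_mul (c := 1) (hηc k).aestronglyMeasurable
        (Eventually.of_forall fun x => by rw [Real.norm_of_nonneg (hη0 k x)]; exact hη1 k x)
    have hi2 : Integrable fun x => t k / (W x + t k) ^ 2 * φ x * ‖gradient W x‖ ^ 2 := by
      have hm : Measurable fun x => t k / (W x + t k) ^ 2 * φ x * ‖gradient W x‖ ^ 2 :=
        ((measurable_const.div ((hW.continuous.measurable.add_const _).pow_const 2)).mul
          hφ.continuous.measurable).mul ((measurable_gradient W).norm.pow_const 2)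
      refine (hφint.const_mul ((t k)⁻¹)).mono' hm.aestronglyMeasurable
        (Eventually.of_forall fun x => ?_)
      have h1 := hW0 x
      have h2 := hφ0 x
      have h3 := ht0 k
      simp only [Pi.zero_apply] at h1 h2
      have h4 : ‖gradient W x‖ ≤ 1 := norm_gradient_le hW x
      rw [Real.norm_of_nonneg (by positivity)]
      have h5 : t k / (W x + t k) ^ 2 ≤ (t k)⁻¹ := by
        rw [div_le_iff₀ (by positivity), inv_mul_eq_div, le_div_iff₀ h3]
        nlinarith [mul_nonneg h1 h3.le]
      calc _ ≤ (t k)⁻¹ * φ x * 1 ^ 2 := by gcongr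
        _ = _ := by ring
    rw [integral_congr_ae hae, integral_add hi1 hi2, ← integral_const_mul] at hψ
    refine ⟨hi2, ?_⟩
    have : ∫ x, η k x * f x = (∫ x, n * ρ⁻¹ * (W x / (W x + t k) * φ x)) -
        ∫ x, η k x * inner ℝ (gradient W x) (gradient φ x) := by
      rw [← integral_sub _ hi1]
      · congr 1; ext x; simp only [f, η]; ring
      · exact (((hφint.bdd_mul (c := 1) (hηc k).aestronglyMeasurable
          (Eventually.of_forall fun x => by
            rw [Real.norm_of_nonneg (hη0 k x)]; exact hη1 k x))).const_mul _)
    linarith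
  have hf0 : 0 ≤ ∫ x in {x | 0 < W x}, f x := by
    refine ge_of_tendsto' hlim fun k => (integral_nonneg fun x => ?_).trans (hweak k).2
    have h2 := hφ0 x
    have h3 := ht0 k
    simp only [Pi.zero_apply] at h2 ⊢
    positivity
  refine ⟨hf0, ?_⟩
  -- On the layer `t / (W + t)² ≥ 1 / (4t)` because `W < t`, and `|∇W|² ≥ 1 / 2` because `t ≤ ρ /
  -- 4`. These two factors produce the constant `8`.
  have hkey : ∀ᶠ k in atTop, ∫⁻ x, ENNReal.ofReal (φ x) ∂layerMeasure M ρ k ≤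
      ENNReal.ofReal (8 * ∫ x, η k x * f x) := by
    filter_upwards [htlim.eventually (ge_mem_nhds (show (0 : ℝ) < ρ / 4 by positivity))] with k hk
    obtain ⟨hi2, hle⟩ := hweak k
    rw [layerMeasure, lintegral_smul_measure, smul_eq_mul,
      ← ofReal_integral_eq_lintegral_ofReal hφint.integrableOn (Eventually.of_forall hφ0),
      ← ENNReal.ofReal_mul (by positivity)]
    apply ENNReal.ofReal_le_ofReal
    refine le_trans ?_ (mul_le_mul_of_nonneg_left hle (by norm_num))
    have hms := (isOpen_collarLayer (M := M) hρ (t k)).measurableSet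
    rw [← integral_indicator hms, ← integral_const_mul, ← integral_const_mul]
    refine integral_mono_ae ((hφint.indicator hms).const_mul _) (hi2.const_mul 8) ?_
    filter_upwards [hW.ae_differentiableAt] with x hx
    have h1 := hW0 x
    have h2 := hφ0 x
    have h3 := ht0 k
    simp only [Pi.zero_apply] at h1 h2
    by_cases hxl : x ∈ collarLayer M ρ (t k)
    · rw [Set.indicator_of_mem hxl, norm_gradient_collar_sq hρ hD (isClosed_ballCenters _ _) hxl.1 hx]
      have hWt : W x < t k := hxl.2
      have hWρ : 2 * W x / ρ ≤ 1 / 2 := by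
        rw [div_le_iff₀ hρ]; linarith
      have h5 : (4 * t k)⁻¹ ≤ t k / (W x + t k) ^ 2 := by
        rw [le_div_iff₀ (by positivity), inv_mul_eq_div, div_le_iff₀ (by positivity)]
        nlinarith
      have h6 : (k + 1 : ℝ) = (t k)⁻¹ := by simp [t]
      calc (k + 1 : ℝ) * φ x = 8 * ((4 * t k)⁻¹ * φ x * (1 / 2)) := by
            rw [h6]; field_simp; ring
        _ ≤ 8 * (t k / (W x + t k) ^ 2 * φ x * (1 - 2 * W x / ρ)) := by
            gcongr
            linarith
    · rw [Set.indicator_of_notMem hxl, mul_zero]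
      positivity
  refine (lintegral_surfaceMeasure_le_liminf hn hρ hS hφ.continuous hφ0).trans ?_
  gcongr
  refine (liminf_le_liminf hkey).trans_eq ?_
  exact ((ENNReal.continuous_ofReal.tendsto _).comp (hlim.const_mul 8)).liminf_eq

/-- The properties of a barrier function near the surface `S` of the solid `M`. -/
structure IsBarrier (M S : Set (E n)) (κ c ρ : ℝ) (W : E n → ℝ) : Prop where
  lipschitz : LipschitzWith 1 W
  nonneg : ∀ x, 0 ≤ W x
  le : ∀ x, W x ≤ ρ
  trace : ∀ φ : E n → ℝ, ∀ L, LipschitzWith L φ → HasCompactSupport φ → 0 ≤ φ →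
    0 ≤ ∫ x in (closure M)ᶜ, (κ * φ x - inner ℝ (gradient W x) (gradient φ x)) ∧
    ∫⁻ x in S, ENNReal.ofReal (φ x) ∂surfaceMeasure n ≤ ENNReal.ofReal (c *
      ∫ x in (closure M)ᶜ, (κ * φ x - inner ℝ (gradient W x) (gradient φ x)))

/-- The collar is the barrier. Enlarging the domain of integration from `{W > 0}` to the complement
of `closure M` only adds `κ φ ≥ 0`, as `∇W` vanishes where `W` does. The order of the quantifiers
records that `κ` and `c` do not depend on the geometry. -/
theorem exists_isBarrier (n : ℕ) (ρ : ℝ) (hρ : 0 < ρ) : ∃ κ c : ℝ, 0 ≤ κ ∧ 0 ≤ c ∧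
    ∀ M S : Set (E n), (∀ p ∈ S, p ∈ closure M ∧ ∃ c ∈ ballCenters M ρ, dist c p = ρ) →
      ∃ W, IsBarrier M S κ c ρ W := by
  refine ⟨n * ρ⁻¹, (layerConst n).toReal * 8, by positivity, by positivity, fun M S hS => ?_⟩
  rcases S.eq_empty_or_nonempty with rfl | ⟨p, hp⟩
  -- Without boundary points there may be no ball centres, so the zero function serves instead.
  · refine ⟨0, LipschitzWith.const' 0, fun _ => le_rfl, fun _ => hρ.le,
      fun φ L _ _ hφ0 => ⟨?_, by simp⟩⟩
    refine integral_nonneg fun x => ?_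
    have := hφ0 x
    simp only [Pi.zero_apply, gradient, fderiv_zero, map_zero, inner_zero_left, sub_zero] at this ⊢
    positivity
  obtain ⟨c, hc, hcp⟩ := (hS p hp).2
  have hD : (ballCenters M ρ).Nonempty := ⟨c, hc⟩
  have hn : n ≠ 0 := by
    rintro rfl
    rw [Subsingleton.elim c p, dist_self] at hcp
    exact hρ.ne hcp
  set W := collar (ballCenters M ρ) ρ
  have hgrad : ∀ x, ¬ 0 < W x → gradient W x = 0 := fun x hx =>
    gradient_collar_eq_zero hρ (le_antisymm (not_lt.1 hx) (collar_nonneg hρ x))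
  refine ⟨W, lipschitzWith_collar hρ, collar_nonneg hρ,
    fun x => (collar_le hρ x).trans (by linarith), fun φ L hφ hφc hφ0 => ?_⟩
  obtain ⟨h0, hle⟩ := lintegral_surfaceMeasure_le_collar hn hρ hD hS hφ hφc hφ0
  suffices hmono : ∫ x in {x | 0 < W x}, (n * ρ⁻¹ * φ x - inner ℝ (gradient W x) (gradient φ x)) ≤
      ∫ x in (closure M)ᶜ, (n * ρ⁻¹ * φ x - inner ℝ (gradient W x) (gradient φ x)) by
    refine ⟨h0.trans hmono, hle.trans ?_⟩
    rw [mul_assoc, ENNReal.ofReal_mul ENNReal.toReal_nonneg,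
      ENNReal.ofReal_toReal (layerConst_ne_top n)]
    exact mul_le_mul_right (ENNReal.ofReal_le_ofReal (mul_le_mul_of_nonneg_left hmono (by norm_num))) _
  have hWm : MeasurableSet {x | 0 < W x} :=
    measurableSet_lt measurable_const (lipschitzWith_collar hρ).continuous.measurable
  have hφint : Integrable φ := hφ.continuous.integrable_of_hasCompactSupport hφc
  have hinner : Integrable fun x => inner ℝ (gradient W x) (gradient φ x) := by
    refine memLp_one_iff_integrable.1 (memLp_of_bounded_of_isCompact
      ((measurable_gradient W).inner (measurable_gradient φ)).aestronglyMeasurable hφc.isCompact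
      (fun x hx => by simp [gradient_eq_zero_of_notMem_tsupport hx]) (c := 1 * L) (fun x => ?_) 1)
    exact (norm_inner_le_norm _ _).trans (mul_le_mul (norm_gradient_le (lipschitzWith_collar hρ) x)
      (norm_gradient_le hφ x) (norm_nonneg _) (by simp))
  have hf := (hφint.const_mul (n * ρ⁻¹)).sub hinner
  have hcm : MeasurableSet (closure M)ᶜ := isClosed_closure.measurableSet.compl
  rw [← integral_indicator hWm, ← integral_indicator hcm]
  refine integral_mono (hf.indicator hWm) (hf.indicator hcm) fun x => ?_
  by_cases hx : 0 < W x
  · rw [Set.indicator_of_mem (show x ∈ {x | 0 < W x} from hx),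
      Set.indicator_of_mem (show x ∈ (closure M)ᶜ from notMem_closure_of_collar_pos hD hx)]
  · rw [Set.indicator_of_notMem (show x ∉ {x | 0 < W x} from hx)]
    by_cases hxM : x ∈ (closure M)ᶜ
    · rw [Set.indicator_of_mem hxM]
      simp only [hgrad x hx, inner_zero_left, sub_zero]
      have := hφ0 x
      simp only [Pi.zero_apply] at this
      positivity
    · rw [Set.indicator_of_notMem hxM]

end Trace

/-! ### Strongly monotone operators -/

section Monotone

variable {H : Type*} [NormedAddCommGroup H] [InnerProductSpace ℝ H] [CompleteSpace H]

/-- A Lipschitz continuous, strongly monotone operator of a Hilbert space is surjective. -/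
theorem surjective_of_strongly_monotone {A : H → H} {L c : ℝ} (hc : 0 < c)
    (hL : ∀ u v, ‖A u - A v‖ ≤ L * ‖u - v‖)
    (hA : ∀ u v, c * ‖u - v‖ ^ 2 ≤ inner ℝ (A u - A v) (u - v)) : Function.Surjective A := by
  intro f
  -- Taking `L' ≥ c` makes `1 - c² / L'²` nonnegative. This is the square of the contraction
  -- constant of `u ↦ u - τ (A u - f)` for the optimal step `τ = c / L'²`.
  set L' := max L c with hL'
  have hcL : c ≤ L' := le_max_right _ _
  have hL0 : 0 < L' := hc.trans_le hcL
  have hLip : ∀ u v, ‖A u - A v‖ ≤ L' * ‖u - v‖ := fun u v =>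
    (hL u v).trans (by gcongr; exact le_max_left _ _)
  set τ := c / L' ^ 2 with hτ
  have hτ0 : 0 < τ := by positivity
  have hq0 : 0 ≤ 1 - c ^ 2 / L' ^ 2 := by
    rw [sub_nonneg, div_le_one (by positivity)]; gcongr
  set q := Real.sqrt (1 - c ^ 2 / L' ^ 2) with hq
  have hq1 : q < 1 := by
    rw [hq, Real.sqrt_lt' one_pos]
    have : 0 < c ^ 2 / L' ^ 2 := by positivity
    linarith
  have hT : ContractingWith q.toNNReal fun u => u - τ • (A u - f) := by
    refine ⟨by simpa using hq1, LipschitzWith.of_dist_le_mul fun u v => ?_⟩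
    rw [Real.coe_toNNReal _ (Real.sqrt_nonneg _), dist_eq_norm, dist_eq_norm,
      show u - τ • (A u - f) - (v - τ • (A v - f)) = (u - v) - τ • (A u - A v) by module]
    refine le_of_sq_le_sq ?_ (by positivity)
    rw [mul_pow, Real.sq_sqrt hq0, norm_sub_sq_real, inner_smul_right, norm_smul,
      real_inner_comm, Real.norm_of_nonneg hτ0.le]
    have h1 := mul_le_mul_of_nonneg_left (hA u v) hτ0.le
    have h2 : (τ * ‖A u - A v‖) ^ 2 ≤ (τ * (L' * ‖u - v‖)) ^ 2 := by
      gcongr; exact hLip u v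
    have h3 : (1 - c ^ 2 / L' ^ 2) * ‖u - v‖ ^ 2 =
        ‖u - v‖ ^ 2 - 2 * (τ * (c * ‖u - v‖ ^ 2)) + (τ * (L' * ‖u - v‖)) ^ 2 := by
      rw [hτ]; field_simp; ring
    rw [h3]
    linarith
  have hfix := hT.fixedPoint_isFixedPt
  refine ⟨ContractingWith.fixedPoint _ hT, ?_⟩
  have : τ • (A (ContractingWith.fixedPoint _ hT) - f) = 0 := by
    have h : _ - τ • (A _ - f) = _ := hfix
    exact sub_eq_self.1 h
  exact sub_eq_zero.1 ((smul_eq_zero.1 this).resolve_left hτ0.ne')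

end Monotone

/-! ### The energy space and the truncated semilinear problem -/

section Sobolev

variable {n : ℕ}

/-- The Lipschitz functions with compact support in `V`. -/
def lipschitzTest (V : Set (E n)) : Submodule ℝ (E n → ℝ) where
  carrier := {ψ | (∃ K, LipschitzWith K ψ) ∧ HasCompactSupport ψ ∧ tsupport ψ ⊆ V}
  zero_mem' := ⟨⟨0, LipschitzWith.const 0⟩, HasCompactSupport.zero, by simp [tsupport]⟩
  add_mem' := by
    rintro φ ψ ⟨⟨K, hK⟩, hc, hs⟩ ⟨⟨K', hK'⟩, hc', hs'⟩
    exact ⟨⟨_, hK.add hK'⟩, hc.add hc', (tsupport_add φ ψ).trans (Set.union_subset hs hs')⟩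
  smul_mem' := by
    rintro a φ ⟨⟨K, hK⟩, hc, hs⟩
    refine ⟨⟨_, (lipschitzWith_smul a).comp hK⟩, hc.smul_left (f := fun _ => a),
      (closure_mono (Function.support_const_smul_subset a φ)).trans hs⟩

variable {U V : Set (E n)}

lemma lipschitzTest.continuous {ψ : E n → ℝ} (h : ψ ∈ lipschitzTest V) : Continuous ψ := by
  obtain ⟨⟨K, hK⟩, -⟩ := h
  exact hK.continuous

lemma lipschitzTest.memLp {ψ : E n → ℝ} (h : ψ ∈ lipschitzTest V) (p : ENNReal) :
    MemLp ψ p volume := by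
  obtain ⟨b, hb⟩ := h.2.1.exists_bound_of_continuous (lipschitzTest.continuous h)
  exact memLp_of_bounded_of_isCompact (lipschitzTest.continuous h).aestronglyMeasurable h.2.1.isCompact
    (fun x hx => image_eq_zero_of_notMem_tsupport hx) hb p

lemma lipschitzTest.memLp_gradient {ψ : E n → ℝ} (h : ψ ∈ lipschitzTest V) (p : ENNReal) :
    MemLp (gradient ψ) p volume := by
  obtain ⟨⟨K, hK⟩, hc, -⟩ := h
  exact memLp_of_bounded_of_isCompact (measurable_gradient ψ).aestronglyMeasurable hc.isCompact
    (fun x hx => gradient_eq_zero_of_notMem_tsupport hx) (norm_gradient_le hK) p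

/-- Pairs of a square integrable function and a square integrable vector field. -/
abbrev H1Ambient (U : Set (E n)) : Type :=
  WithLp 2 (Lp ℝ 2 (volume.restrict U) × Lp (E n) 2 (volume.restrict U))

/-- A Lipschitz test function together with its gradient. -/
def lipschitzEmbedding (U V : Set (E n)) : lipschitzTest V →ₗ[ℝ] H1Ambient U where
  toFun ψ := WithLp.toLp 2 (((lipschitzTest.memLp ψ.2 2).restrict U).toLp ψ.1,
    ((lipschitzTest.memLp_gradient ψ.2 2).restrict U).toLp (gradient ψ.1))
  map_add' φ ψ := by
    rw [← WithLp.toLp_add, Prod.mk_add_mk, ← MemLp.toLp_add, ← MemLp.toLp_add]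
    congr 2
    rw [MemLp.toLp_eq_toLp_iff]
    obtain ⟨⟨K, hK⟩, -⟩ := φ.2
    obtain ⟨⟨K', hK'⟩, -⟩ := ψ.2
    filter_upwards [ae_restrict_of_ae hK.ae_differentiableAt,
      ae_restrict_of_ae hK'.ae_differentiableAt] with x h1 h2
    simp [gradient, fderiv_add h1 h2]
  map_smul' a ψ := by
    rw [RingHom.id_apply, ← WithLp.toLp_smul, Prod.smul_mk, ← MemLp.toLp_const_smul,
      ← MemLp.toLp_const_smul]
    congr 2
    rw [MemLp.toLp_eq_toLp_iff]
    obtain ⟨⟨K, hK⟩, -⟩ := ψ.2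
    filter_upwards [ae_restrict_of_ae hK.ae_differentiableAt] with x h1
    simp [gradient, fderiv_const_smul h1]

/-- The Sobolev space of functions on `U` that vanish on the boundary of `V`. -/
def h1Space (U V : Set (E n)) : Submodule ℝ (H1Ambient U) :=
  (LinearMap.range (lipschitzEmbedding U V)).topologicalClosure

lemma lipschitzEmbedding_mem (ψ : lipschitzTest V) : lipschitzEmbedding U V ψ ∈ h1Space U V :=
  Submodule.le_topologicalClosure _ (LinearMap.mem_range_self _ ψ)

lemma lipschitzEmbedding_fst (ψ : lipschitzTest V) :
    (lipschitzEmbedding U V ψ).fst =ᵐ[volume.restrict U] ψ.1 :=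
  ((lipschitzTest.memLp ψ.2 2).restrict U).coeFn_toLp

lemma lipschitzEmbedding_snd (ψ : lipschitzTest V) :
    (lipschitzEmbedding U V ψ).snd =ᵐ[volume.restrict U] gradient ψ.1 :=
  ((lipschitzTest.memLp_gradient ψ.2 2).restrict U).coeFn_toLp

instance : CompleteSpace (h1Space U V) :=
  (Submodule.isClosed_topologicalClosure _).completeSpace_coe

/-- Solvability of a semilinear problem with a strongly monotone, Lipschitz nonlinearity. -/
theorem exists_mem_h1Space_of_strongly_monotone {h : ℝ → ℝ} {K : NNReal} {c B : ℝ}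
    (hK : LipschitzWith K h) (h0 : h 0 = 0) (hc : 0 < c) (hc1 : c ≤ 1)
    (hmono : ∀ s t, c * (s - t) ^ 2 ≤ (h s - h t) * (s - t))
    (ℓ : lipschitzTest V →ₗ[ℝ] ℝ) (hB : 0 ≤ B) (hℓ : ∀ ψ, |ℓ ψ| ≤ B * ‖lipschitzEmbedding U V ψ‖) :
    ∃ u ∈ h1Space U V, c * ‖u‖ ≤ B ∧ ∀ ψ, inner ℝ u.snd (lipschitzEmbedding U V ψ).snd +
      inner ℝ (hK.compLp h0 u.fst) (lipschitzEmbedding U V ψ).fst = ℓ ψ := by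
  let e : lipschitzTest V →ₗ[ℝ] h1Space U V :=
    (lipschitzEmbedding U V).codRestrict _ lipschitzEmbedding_mem
  have he : DenseRange e := by
    intro x
    rw [closure_subtype, ← Set.range_comp]
    exact x.2
  let F : h1Space U V →L[ℝ] ℝ := ℓ.extendOfNorm e
  have hF : ∀ ψ, F (e ψ) = ℓ ψ := LinearMap.extendOfNorm_eq he ⟨B, hℓ⟩
  have hFn : ‖F‖ ≤ B := F.opNorm_le_bound hB (LinearMap.norm_extendOfNorm_apply_le he B hℓ)
  let f : h1Space U V := (InnerProductSpace.toDual ℝ _).symm F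
  have hf : ∀ v, inner ℝ f v = F v := fun v => InnerProductSpace.toDual_symm_apply
  let Nl : H1Ambient U → H1Ambient U := fun u => WithLp.toLp 2 (hK.compLp h0 u.fst, u.snd)
  let P := (h1Space U V).orthogonalProjectionOnto
  have hP : ∀ (x : H1Ambient U) (v : h1Space U V), inner ℝ (P x) v = inner ℝ x (v : H1Ambient U) :=
    fun x v => Submodule.inner_orthogonalProjectionOnto_eq_of_mem_right v x
  -- The weak equation on the closed subspace is `A u = f`, where `f` represents the extension of
  -- `ℓ` by density. Projecting keeps the Lipschitz bound and the monotonicity of `Nl`; the gradient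
  -- component is monotone with constant `1 ≥ c`.
  let A : h1Space U V → h1Space U V := fun u => P (Nl u)
  have hNmono : ∀ u v : H1Ambient U, c * ‖u - v‖ ^ 2 ≤ inner ℝ (Nl u - Nl v) (u - v) := by
    intro u v
    rw [WithLp.prod_norm_sq_eq_of_L2, WithLp.prod_inner_apply]
    have h1 : c * ‖(u - v).fst‖ ^ 2 ≤ inner ℝ (Nl u - Nl v).fst (u - v).fst := by
      rw [← real_inner_self_eq_norm_sq, L2.inner_def, L2.inner_def, ← integral_const_mul]
      refine integral_mono_ae ((L2.integrable_inner _ _).const_mul _) (L2.integrable_inner _ _) ?_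
      filter_upwards [hK.coeFn_compLp h0 u.fst, hK.coeFn_compLp h0 v.fst,
        Lp.coeFn_sub (hK.compLp h0 u.fst) (hK.compLp h0 v.fst), Lp.coeFn_sub u.fst v.fst]
        with x e1 e2 e3 e4
      have := hmono (u.fst x) (v.fst x)
      change c * inner ℝ ((u.fst - v.fst : Lp ℝ 2 (volume.restrict U)) x)
        ((u.fst - v.fst : Lp ℝ 2 (volume.restrict U)) x) ≤
        inner ℝ ((hK.compLp h0 u.fst - hK.compLp h0 v.fst : Lp ℝ 2 (volume.restrict U)) x)
          ((u.fst - v.fst : Lp ℝ 2 (volume.restrict U)) x)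
      rw [e3, e4, Pi.sub_apply, Pi.sub_apply, e1, e2]
      simp
      nlinarith
    have h2 : inner ℝ (Nl u - Nl v).snd (u - v).snd = ‖(u - v).snd‖ ^ 2 := by
      rw [← real_inner_self_eq_norm_sq]; rfl
    have h3 := sq_nonneg ‖(u - v).snd‖
    change _ ≤ inner ℝ (Nl u - Nl v).fst (u - v).fst + inner ℝ (Nl u - Nl v).snd (u - v).snd
    rw [h2]
    nlinarith
  have hNlip : ∀ u v : H1Ambient U, ‖Nl u - Nl v‖ ≤ max K 1 * ‖u - v‖ := by
    intro u v
    refine le_of_sq_le_sq ?_ (by positivity)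
    rw [mul_pow, WithLp.prod_norm_sq_eq_of_L2, WithLp.prod_norm_sq_eq_of_L2, mul_add]
    have h1 : ‖(Nl u - Nl v).fst‖ ≤ K * ‖(u - v).fst‖ := by
      have := (hK.lipschitzWith_compLp h0).dist_le_mul u.fst v.fst
      rwa [dist_eq_norm, dist_eq_norm] at this
    have h2 : (Nl u - Nl v).snd = (u - v).snd := rfl
    have h3 : (K : ℝ) ≤ max K 1 := le_max_left _ _
    have h4 : (1 : ℝ) ≤ max K 1 := le_max_right _ _
    rw [h2, ← mul_pow]
    gcongr
    · exact h1.trans (by gcongr)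
    · exact le_mul_of_one_le_left (sq_nonneg _) (one_le_pow₀ h4)
  have hAsurj : Function.Surjective A := by
    refine surjective_of_strongly_monotone (L := max K 1) hc (fun u v => ?_) (fun u v => ?_)
    · simp only [A]
      rw [← map_sub]
      refine ((P.le_opNorm _).trans ?_).trans (hNlip u v)
      exact mul_le_of_le_one_left (norm_nonneg _) (Submodule.orthogonalProjectionOnto_norm_le _)
    · simp only [A]
      rw [← map_sub, hP]
      exact hNmono u v
  obtain ⟨u, hu⟩ := hAsurj f
  have hmain : ∀ v : h1Space U V, inner ℝ (Nl u) (v : H1Ambient U) = F v := by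
    intro v
    rw [← hP, ← hf, ← hu]
  refine ⟨u, u.2, ?_, fun ψ => ?_⟩
  -- The norm bound comes from testing the equation with `u` itself.
  · have h1 := hNmono u 0
    have h2 : Nl 0 = 0 := by
      have : ‖Nl 0‖ ≤ 0 := by
        have := (hK.norm_compLp_le h0 (0 : Lp ℝ 2 (volume.restrict U)))
        rw [norm_zero, mul_zero] at this
        have h3 : hK.compLp h0 (0 : Lp ℝ 2 (volume.restrict U)) = 0 := norm_le_zero_iff.1 this
        change ‖WithLp.toLp 2 (hK.compLp h0 (0 : Lp ℝ 2 (volume.restrict U)),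
          (0 : Lp (E n) 2 (volume.restrict U)))‖ ≤ 0
        rw [h3]
        exact norm_zero.le
      exact norm_le_zero_iff.1 this
    rw [h2, sub_zero, sub_zero, hmain u] at h1
    have h3 : F u ≤ B * ‖u‖ := (le_abs_self _).trans
      ((F.le_opNorm u).trans (by gcongr))
    rcases (norm_nonneg u).eq_or_lt with hu0 | hu0
    · have : ‖(u : H1Ambient U)‖ = 0 := hu0.symm
      rw [this]; simpa using hB
    · have h4 : c * ‖u‖ * ‖u‖ ≤ B * ‖u‖ := by
        refine le_trans (le_of_eq ?_) (h1.trans h3)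
        rw [Submodule.coe_norm]; ring
      exact le_of_mul_le_mul_right h4 hu0
  · rw [← hF, ← hmain, WithLp.prod_inner_apply, add_comm]
    rfl

end Sobolev

/-! ### The maximum principle with barrier -/

section Maximum

variable {n : ℕ} {U V : Set (E n)}

lemma inner_eq_integral {F : Type*} [NormedAddCommGroup F] [InnerProductSpace ℝ F]
    {X : Type*} [MeasurableSpace X] {μ : Measure X} {f g : Lp F 2 μ} {f' g' : X → F}
    (hf : f =ᵐ[μ] f') (hg : g =ᵐ[μ] g') : inner ℝ f g = ∫ x, inner ℝ (f' x) (g' x) ∂μ := by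
  rw [L2.inner_def]
  refine integral_congr_ae ?_
  filter_upwards [hf, hg] with x h1 h2
  rw [h1, h2]

lemma tendsto_lipschitzEmbedding_of_mem {u : H1Ambient U} (hu : u ∈ h1Space U V) :
    ∃ φ : ℕ → lipschitzTest V, Tendsto (fun k => lipschitzEmbedding U V (φ k)) atTop (𝓝 u) := by
  obtain ⟨x, hx, hxu⟩ := mem_closure_iff_seq_limit.1 hu
  choose φ hφ using hx
  exact ⟨φ, by simpa only [hφ] using hxu⟩

/-- At a point of differentiability, the gradient of the positive part of `f` is that of `f` or
zero. -/
lemma inner_gradient_gradient_max_zero {f : E n → ℝ} {x : E n} (hf : ContinuousAt f x) :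
    inner ℝ (gradient f x) (gradient (fun y => max (f y) 0) x) =
      ‖gradient (fun y => max (f y) 0) x‖ ^ 2 := by
  rcases lt_or_ge 0 (f x) with h | h
  · have : (fun y => max (f y) 0) =ᶠ[𝓝 x] f := by
      filter_upwards [hf.eventually (lt_mem_nhds h)] with y hy
      exact max_eq_left hy.le
    rw [gradient, gradient, this.fderiv_eq, real_inner_self_eq_norm_sq]
  · have : IsLocalMin (fun y => max (f y) 0) x := by
      apply Eventually.of_forall
      intro y
      simp [max_eq_right h]
    simp [gradient, this.fderiv_eq_zero]

/-- The truncations `(φ + AW - m)⁺` of test functions are test functions. -/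
lemma max_add_mem_lipschitzTest {φ w : E n → ℝ} (hφ : φ ∈ lipschitzTest V) {K : NNReal}
    (hw : LipschitzWith K w) (hw0 : ∀ x, w x ≤ 0) :
    (fun x => max (φ x + w x) 0) ∈ lipschitzTest V := by
  obtain ⟨⟨L, hL⟩, hc, hs⟩ := hφ
  have hsub : Function.support (fun x => max (φ x + w x) 0) ⊆ Function.support φ := by
    intro x hx hx0
    apply hx
    simp only [hx0, zero_add]
    exact max_eq_right (hw0 x)
  exact ⟨⟨_, (hL.add hw).max_const 0⟩, hc.mono hsub, (closure_mono hsub).trans hs⟩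

/-- Maximum principle: a subsolution is bounded by means of the barrier `W`. -/
theorem ae_le_of_subsolution {u : H1Ambient U} (hu : u ∈ h1Space U V) (hUfin : volume U ≠ ⊤)
    {h : ℝ → ℝ} {K : NNReal} (hK : LipschitzWith K h) (h0 : h 0 = 0) {W : E n → ℝ}
    (hW : LipschitzWith 1 W) {ρ A κ m : ℝ} (hWρ : ∀ x, W x ≤ ρ)
    (hW0 : ∀ x, 0 ≤ W x) (hA : 0 ≤ A) (hm : 0 ≤ m) (hmh : ∀ s, m < s → A * κ < h s)
    (hsub : ∀ ψ : lipschitzTest V, 0 ≤ ψ.1 →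
      inner ℝ u.snd (lipschitzEmbedding U V ψ).snd +
        inner ℝ (hK.compLp h0 u.fst) (lipschitzEmbedding U V ψ).fst ≤
      A * ∫ x in U, (κ * ψ.1 x - inner ℝ (gradient W x) (gradient ψ.1 x))) :
    ∀ᵐ x ∂volume.restrict U, u.fst x ≤ m + A * ρ := by
  have : IsFiniteMeasure (volume.restrict U) := isFiniteMeasure_restrict.2 hUfin
  obtain ⟨φ, hφ⟩ := tendsto_lipschitzEmbedding_of_mem hu
  -- The comparison function is `-w = m + A (ρ - W) ≥ m`. As `w ≤ 0`, the test functions `(φ k +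
  -- w)⁺` inherit the compact support of `φ k` in `V`.
  let w : E n → ℝ := fun x => A * W x - (m + A * ρ)
  have hw0 : ∀ x, w x ≤ 0 := fun x => by
    have := mul_le_mul_of_nonneg_left (hWρ x) hA
    simp only [w]; linarith
  obtain ⟨Kw, hwL⟩ : ∃ Kw, LipschitzWith Kw w :=
    ⟨_, ((lipschitzWith_smul A).comp hW).sub (LipschitzWith.const (m + A * ρ))⟩
  have hwgrad : ∀ x, DifferentiableAt ℝ W x → gradient w x = A • gradient W x := by
    intro x hx
    have h1 : fderiv ℝ w x = A • fderiv ℝ W x := by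
      simp only [w]
      rw [fderiv_sub_const, fderiv_const_mul hx]
    simp [gradient, h1]
  let ψ : ℕ → lipschitzTest V := fun k =>
    ⟨fun x => max ((φ k).1 x + w x) 0, max_add_mem_lipschitzTest (φ k).2 hwL hw0⟩
  let hu' := hK.compLp h0 u.fst
  let q : E n → ℝ := fun x => hu' x - A * κ
  have hq : MemLp q 2 (volume.restrict U) := (Lp.memLp hu').sub (memLp_const _)
  let p : E n → ℝ := fun x => max (u.fst x + w x) 0
  have hp : MemLp p 2 (volume.restrict U) := by
    refine (Lp.memLp u.fst).mono ?_ (Eventually.of_forall fun x => ?_)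
    · exact (((Lp.aestronglyMeasurable u.fst).add hwL.continuous.aestronglyMeasurable).sup
        aestronglyMeasurable_const)
    · rw [Real.norm_of_nonneg (le_max_right _ _)]
      exact max_le ((add_le_of_nonpos_right (hw0 x)).trans (le_abs_self _)) (norm_nonneg _)
  let Q := hq.toLp q
  let P := hp.toLp p
  let d : ℕ → H1Ambient U := fun k => u - lipschitzEmbedding U V (φ k)
  have hd : Tendsto (fun k => ‖d k‖) atTop (𝓝 0) := by
    have := (tendsto_const_nhds (x := u)).sub hφ
    rw [sub_self] at this
    exact tendsto_zero_iff_norm_tendsto_zero.1 this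
  have hdist : ∀ k, ‖(lipschitzEmbedding U V (ψ k)).fst - P‖ ≤ ‖d k‖ := by
    intro k
    have h1 : ‖(lipschitzEmbedding U V (ψ k)).fst - P‖ ≤
        ‖u.fst - (lipschitzEmbedding U V (φ k)).fst‖ := by
      apply Lp.norm_le_norm_of_ae_le
      filter_upwards [Lp.coeFn_sub (lipschitzEmbedding U V (ψ k)).fst P,
        Lp.coeFn_sub u.fst (lipschitzEmbedding U V (φ k)).fst, lipschitzEmbedding_fst (U := U) (ψ k),
        lipschitzEmbedding_fst (U := U) (φ k), hp.coeFn_toLp] with x e1 e2 e3 e4 e5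
      rw [e1, e2, Pi.sub_apply, Pi.sub_apply, e3, e4, e5]
      simp only [ψ, p, Real.norm_eq_abs]
      refine (abs_max_sub_max_le_abs _ _ _).trans_eq ?_
      rw [abs_sub_comm]; congr 1; ring
    exact h1.trans (WithLp.norm_fst_le (p := 2) _ (d k))
  -- On the set where `ψ k > 0` its gradient is that of `φ k + A W`, so the gradient terms sum to
  -- `‖G‖²` plus an error of size at most `‖d k‖ ‖G‖`. The square absorbs the error, and convergence
  -- of the gradients of `ψ k` is never needed.
  have hkey : ∀ k, inner ℝ Q (lipschitzEmbedding U V (ψ k)).fst ≤ ‖d k‖ ^ 2 := by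
    intro k
    have hs := hsub (ψ k) (fun x => le_max_right _ _)
    set G := (lipschitzEmbedding U V (ψ k)).snd with hG
    have iψ : Integrable (ψ k).1 (volume.restrict U) :=
      (memLp_one_iff_integrable.1 (lipschitzTest.memLp (ψ k).2 1)).restrict
    have iWψ : Integrable (fun x => inner ℝ (gradient W x) (gradient (ψ k).1 x))
        (volume.restrict U) := by
      have h2 := (memLp_one_iff_integrable.1 (lipschitzTest.memLp_gradient (ψ k).2 1)).restrict
        (s := U)
      refine h2.norm.mono' ((measurable_gradient W).inner
        (measurable_gradient _)).aestronglyMeasurable (Eventually.of_forall fun x => ?_)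
      refine (norm_inner_le_norm _ _).trans (mul_le_of_le_one_left (norm_nonneg _) ?_)
      exact norm_gradient_le hW x
    have e1 : inner ℝ Q (lipschitzEmbedding U V (ψ k)).fst =
        inner ℝ hu' (lipschitzEmbedding U V (ψ k)).fst - A * κ * ∫ x in U, (ψ k).1 x := by
      rw [inner_eq_integral hq.coeFn_toLp (lipschitzEmbedding_fst (ψ k)),
        inner_eq_integral (f := hu') (f' := hu') (EventuallyEq.refl _ _)
          (lipschitzEmbedding_fst (ψ k)), ← integral_const_mul, ← integral_sub]
      · congr 1; ext x; simp [q]; ring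
      · refine (L2.integrable_inner (𝕜 := ℝ) hu' (lipschitzEmbedding U V (ψ k)).fst).congr ?_
        filter_upwards [lipschitzEmbedding_fst (U := U) (ψ k)] with x hx
        rw [hx]
      · exact iψ.const_mul _
    have e2 : inner ℝ (lipschitzEmbedding U V (φ k)).snd G +
        A * ∫ x in U, inner ℝ (gradient W x) (gradient (ψ k).1 x) = ‖G‖ ^ 2 := by
      rw [← real_inner_self_eq_norm_sq,
        inner_eq_integral (lipschitzEmbedding_snd (φ k)) (lipschitzEmbedding_snd (ψ k)),
        inner_eq_integral (lipschitzEmbedding_snd (ψ k)) (lipschitzEmbedding_snd (ψ k)),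
        ← integral_const_mul, ← integral_add]
      · obtain ⟨⟨L, hL⟩, -⟩ := (φ k).2
        refine integral_congr_ae ?_
        filter_upwards [ae_restrict_of_ae hL.ae_differentiableAt,
          ae_restrict_of_ae hW.ae_differentiableAt, ae_restrict_of_ae hwL.ae_differentiableAt]
          with x h1 h2 h3
        have h4 : gradient (fun x => (φ k).1 x + w x) x = gradient (φ k).1 x + A • gradient W x := by
          rw [← hwgrad x h2]
          have := fderiv_add h1 h3
          have h5 : fderiv ℝ (fun x => (φ k).1 x + w x) x = _ := this
          simp [gradient, h5]
        have h5 := inner_gradient_gradient_max_zero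
          (hL.continuous.add hwL.continuous).continuousAt (x := x)
        have h6 : gradient ((φ k).1 + w) x = gradient (φ k).1 x + A • gradient W x := h4
        rw [h6, inner_add_left, inner_smul_left] at h5
        rw [real_inner_self_eq_norm_sq]
        exact h5
      · refine (L2.integrable_inner (𝕜 := ℝ) (lipschitzEmbedding U V (φ k)).snd G).congr ?_
        filter_upwards [lipschitzEmbedding_snd (U := U) (φ k), lipschitzEmbedding_snd (U := U) (ψ k)]
          with x hx hx'
        rw [hx, hx']
      · exact iWψ.const_mul A
    rw [integral_sub (iψ.const_mul κ) iWψ, integral_const_mul] at hs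
    have e3 : inner ℝ u.snd G = inner ℝ (d k).snd G + inner ℝ (lipschitzEmbedding U V (φ k)).snd G := by
      rw [← inner_add_left]
      congr 1
      exact (sub_add_cancel _ _).symm
    have e4 : -(‖(d k).snd‖ * ‖G‖) ≤ inner ℝ (d k).snd G :=
      neg_le_of_abs_le (abs_real_inner_le_norm _ _)
    have e5 : ‖(d k).snd‖ ≤ ‖d k‖ := WithLp.norm_snd_le (p := 2) _ (d k)
    rw [e1]
    have e6 : ‖(d k).snd‖ ^ 2 ≤ ‖d k‖ ^ 2 := by gcongr
    nlinarith [sq_nonneg (‖(d k).snd‖ - ‖G‖), sq_nonneg (‖(d k).snd‖ + ‖G‖)]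
  have hlim : Tendsto (fun k => inner ℝ Q (lipschitzEmbedding U V (ψ k)).fst) atTop
      (𝓝 (inner ℝ Q P)) := by
    refine tendsto_const_nhds.inner ?_
    rw [tendsto_iff_norm_sub_tendsto_zero]
    exact squeeze_zero (fun _ => norm_nonneg _) hdist hd
  have hQP : inner ℝ Q P ≤ 0 := by
    have h2 := hd.pow 2
    rw [zero_pow two_ne_zero] at h2
    exact le_of_tendsto_of_tendsto' hlim h2 hkey
  rw [inner_eq_integral hq.coeFn_toLp hp.coeFn_toLp] at hQP
  -- Where `u + w > 0` one has `u > m`, hence `h u > A κ`. The integrand is nonnegative with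
  -- nonpositive integral, which forces `u + w ≤ 0`.
  have hpos : 0 ≤ᵐ[volume.restrict U] fun x => inner ℝ (q x) (p x) := by
    filter_upwards [hK.coeFn_compLp h0 u.fst] with x hx
    simp only [q, p, hu', hx, Pi.zero_apply, Function.comp]
    rcases le_or_gt (u.fst x + w x) 0 with h1 | h1
    · simp [max_eq_right h1]
    · rw [max_eq_left h1.le]
      have := hmh (u.fst x) (by
        have := mul_le_mul_of_nonneg_left (hWρ x) hA
        simp only [w] at h1; linarith)
      exact mul_nonneg h1.le (by simpa using this.le)
  have hint : Integrable (fun x => inner ℝ (q x) (p x)) (volume.restrict U) := by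
    refine (L2.integrable_inner (𝕜 := ℝ) Q P).congr ?_
    filter_upwards [hq.coeFn_toLp, hp.coeFn_toLp] with x h1 h2
    rw [h1, h2]
  have hzero := (integral_eq_zero_iff_of_nonneg_ae hpos hint).1
    (le_antisymm hQP (integral_nonneg_of_ae hpos))
  filter_upwards [hzero, hK.coeFn_compLp h0 u.fst] with x hx hx'
  by_contra! hc
  have h1 : 0 < u.fst x + w x := by
    have := mul_nonneg hA (hW0 x)
    simp only [w]; linarith
  have h2 := hmh (u.fst x) (by
    have := mul_nonneg hA ((hW0 x).trans (hWρ x)); linarith)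
  simp only [q, p, hu', hx', Pi.zero_apply, Function.comp, max_eq_left h1.le] at hx
  rcases mul_eq_zero.1 hx with h3 | h3
  · exact h1.ne' h3
  · simp at h3
    linarith

end Maximum

/-! ### Smooth approximation of Lipschitz test functions -/

section Mollification

open scoped Convolution
open ContinuousLinearMap (lsmul)

variable {n : ℕ} {V : Set (E n)}

lemma tendsto_eLpNorm_zero_of_bounded {F : Type*} [NormedAddCommGroup F] {f : ℕ → E n → F}
    (hf : ∀ k, AEStronglyMeasurable (f k) volume) {K : Set (E n)} (hK : IsCompact K)
    (h0 : ∀ k, ∀ x ∉ K, f k x = 0) {c : ℝ} (hc : ∀ k x, ‖f k x‖ ≤ c)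
    (hlim : ∀ᵐ x, Tendsto (fun k => f k x) atTop (𝓝 0)) :
    Tendsto (fun k => eLpNorm (f k) 2 volume) atTop (𝓝 0) := by
  have h1 : Tendsto (fun k => ∫⁻ x, ‖f k x‖ₑ ^ (2 : ℝ)) atTop (𝓝 (∫⁻ _ : E n, 0)) := by
    refine tendsto_lintegral_of_dominated_convergence'
      (K.indicator fun _ => ENNReal.ofReal c ^ (2 : ℝ))
      (fun k => (hf k).enorm.pow_const _) (fun k => Eventually.of_forall fun x => ?_) ?_ ?_
    · by_cases hx : x ∈ K
      · simp only [Set.indicator_of_mem hx]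
        gcongr
        rw [← ofReal_norm]
        exact ENNReal.ofReal_le_ofReal (hc k x)
      · simp [hx, h0 k x hx]
    · rw [lintegral_indicator hK.measurableSet, lintegral_const, Measure.restrict_apply_univ]
      exact ENNReal.mul_ne_top (by simp) hK.measure_lt_top.ne
    · filter_upwards [hlim] with x hx
      have := (hx.enorm).ennrpow_const 2
      simpa using this
  simp only [lintegral_zero] at h1
  have h2 := h1.ennrpow_const (1 / 2)
  simp only [eLpNorm_eq_lintegral_rpow_enorm_toReal (two_ne_zero) ENNReal.ofNat_ne_top,
    ENNReal.toReal_ofNat]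
  simpa using h2

variable {F : Type*} [NormedAddCommGroup F] [NormedSpace ℝ F]

lemma norm_normed_convolution_le (b : ContDiffBump (0 : E n)) {g : E n → F} {c : ℝ}
    (hc : ∀ x, ‖g x‖ ≤ c) (x : E n) : ‖(b.normed volume ⋆[lsmul ℝ ℝ, volume] g) x‖ ≤ c := by
  rw [convolution_def]
  calc _ ≤ ∫ y, b.normed volume y * c := by
        refine norm_integral_le_of_norm_le (b.integrable_normed.mul_const c)
          (Eventually.of_forall fun y => ?_)
        rw [ContinuousLinearMap.lsmul_apply, norm_smul, Real.norm_of_nonneg (b.nonneg_normed y)]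
        exact mul_le_mul_of_nonneg_left (hc _) (b.nonneg_normed y)
    _ = c := by rw [integral_mul_const, b.integral_normed, one_mul]

lemma normed_convolution_eq_zero (b : ContDiffBump (0 : E n)) {δ : ℝ} (hb : b.rOut ≤ δ)
    {g : E n → F} {S : Set (E n)} (hS : ∀ x ∉ S, g x = 0) {x : E n}
    (hx : x ∉ Metric.cthickening δ S) : (b.normed volume ⋆[lsmul ℝ ℝ, volume] g) x = 0 := by
  rw [convolution_def]
  refine integral_eq_zero_of_ae (Eventually.of_forall fun y => ?_)
  by_cases hy : y ∈ Function.support (b.normed volume)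
  · rw [b.support_normed_eq, mem_ball_zero_iff] at hy
    have : g (x - y) = 0 := by
      apply hS
      intro h
      apply hx
      refine Metric.mem_cthickening_of_dist_le x (x - y) _ _ h ?_
      rw [dist_eq_norm, sub_sub_cancel]
      exact hy.le.trans hb
    simp [this]
  · rw [Function.notMem_support] at hy
    simp [hy]

/-- Both sides are limits of the same difference quotients, which are moved from the convolution
onto the Lipschitz factor `ψ`. -/
lemma gradient_normed_convolution (b : ContDiffBump (0 : E n)) {ψ : E n → ℝ}
    (hψ : ψ ∈ lipschitzTest V) (x : E n) :
    gradient (b.normed volume ⋆[lsmul ℝ ℝ, volume] ψ) x =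
      (b.normed volume ⋆[lsmul ℝ ℝ, volume] gradient ψ) x := by
  obtain ⟨⟨K, hK⟩, hc, -⟩ := id hψ
  have hsm : ContDiff ℝ 1 (b.normed volume ⋆[lsmul ℝ ℝ, volume] ψ) :=
    b.hasCompactSupport_normed.contDiff_convolution_left _ b.contDiff_normed
      hK.continuous.locallyIntegrable
  have hbi : Integrable (b.normed (volume : Measure (E n))) := b.integrable_normed
  refine ext_inner_right ℝ fun v => ?_
  have hd : DifferentiableAt ℝ (b.normed volume ⋆[lsmul ℝ ℝ, volume] ψ) x :=
    hsm.differentiable one_ne_zero x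
  have hf : LipschitzWith K fun y => ψ (x - y) := by
    have := hK.comp (LipschitzWith.of_dist_le_mul (K := 1) (f := fun y : E n => x - y)
      (fun y z => by rw [dist_sub_left]; simp))
    simpa using! this
  have hlim := hf.integral_inv_smul_sub_mul_tendsto_integral_lineDeriv_mul hbi (-v)
  have hlim2 := (hd.lineDifferentiableAt (v := v)).hasLineDerivAt.tendsto_slope_zero_right
  have hint : ∀ z, Integrable fun y => b.normed volume y * ψ (z - y) := by
    intro z
    obtain ⟨B, hB⟩ := hc.exists_bound_of_continuous hK.continuous
    exact hbi.mul_bdd (c := B) (hK.continuous.comp (by fun_prop)).aestronglyMeasurable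
      (Eventually.of_forall fun y => hB _)
  have heq : (fun t : ℝ => t⁻¹ • ((b.normed volume ⋆[lsmul ℝ ℝ, volume] ψ) (x + t • v) -
      (b.normed volume ⋆[lsmul ℝ ℝ, volume] ψ) x)) =
      fun t : ℝ => ∫ y, (t⁻¹ • (ψ (x - (y + t • -v)) - ψ (x - y))) * b.normed volume y := by
    ext t
    simp only [convolution_def, ContinuousLinearMap.lsmul_apply, smul_eq_mul]
    rw [← integral_sub (hint _) (hint _), ← integral_const_mul]
    congr 1; ext y
    rw [show x - (y + t • -v) = x + t • v - y by rw [smul_neg]; abel]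
    ring
  rw [heq] at hlim2
  rw [inner_gradient_eq_lineDeriv hd, tendsto_nhds_unique hlim2 hlim, convolution_def]
  have hgi : Integrable fun y => b.normed volume y • gradient ψ (x - y) :=
    hbi.smul_bdd K ((measurable_gradient ψ).comp (measurable_const.sub measurable_id)).aestronglyMeasurable
      (Eventually.of_forall fun y => norm_gradient_le hK _)
  simp only [ContinuousLinearMap.lsmul_apply]
  rw [real_inner_comm, ← integral_inner hgi]
  refine integral_congr_ae ?_
  have hae : ∀ᵐ y, DifferentiableAt ℝ ψ (x - y) :=
    (quasiMeasurePreserving_sub_left_of_right_invariant volume x).ae hK.ae_differentiableAt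
  filter_upwards [hae] with y hy
  rw [real_inner_comm, inner_smul_left, inner_gradient_eq_lineDeriv hy]
  have : lineDeriv ℝ (fun y => ψ (x - y)) y (-v) = lineDeriv ℝ ψ (x - y) v := by
    unfold lineDeriv
    congr 1; ext t
    simp only
    rw [show x - (y + t • -v) = x - y + t • v by rw [smul_neg]; abel]
  rw [this]
  simp [mul_comm]

/-- Lipschitz test functions are limits of smooth test functions in `H¹`. -/
theorem exists_seq_isTestFunction (hV : IsOpen V) {ψ : E n → ℝ} (hψ : ψ ∈ lipschitzTest V) :
    ∃ φ : ℕ → E n → ℝ, (∀ k, IsTestFunction V (φ k)) ∧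
      Tendsto (fun k => eLpNorm (fun x => φ k x - ψ x) 2 volume) atTop (𝓝 0) ∧
      Tendsto (fun k => eLpNorm (fun x => gradient (φ k) x - gradient ψ x) 2 volume)
        atTop (𝓝 0) := by
  obtain ⟨⟨K, hK⟩, hc, hs⟩ := id hψ
  obtain ⟨δ, hδ, hδV⟩ := hc.isCompact.exists_cthickening_subset_open hV hs
  let b : ℕ → ContDiffBump (0 : E n) := fun k =>
    ⟨δ / (k + 1) / 2, δ / (k + 1), by positivity, half_lt_self (by positivity)⟩
  have hbδ : ∀ k, (b k).rOut ≤ δ := fun k => div_le_self hδ.le (by simp)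
  have hblim : Tendsto (fun k => (b k).rOut) atTop (𝓝 0) := by
    have := (tendsto_one_div_add_atTop_nhds_zero_nat (𝕜 := ℝ)).const_mul δ
    simpa [b, div_eq_mul_inv] using this
  let φ : ℕ → E n → ℝ := fun k => (b k).normed volume ⋆[lsmul ℝ ℝ, volume] ψ
  have hcpt : IsCompact (Metric.cthickening δ (tsupport ψ)) := hc.isCompact.cthickening
  have hloc : LocallyIntegrable (gradient ψ) :=
    (memLp_one_iff_integrable.1 (lipschitzTest.memLp_gradient hψ 1)).locallyIntegrable
  have hsmooth : ∀ k, ContDiff ℝ (⊤ : ℕ∞) (φ k) := fun k =>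
    (b k).hasCompactSupport_normed.contDiff_convolution_left _ (b k).contDiff_normed
      hK.continuous.locallyIntegrable
  have hzero : ∀ k, ∀ x ∉ Metric.cthickening δ (tsupport ψ), φ k x = 0 := fun k x hx =>
    normed_convolution_eq_zero (b k) (hbδ k) (fun y hy => image_eq_zero_of_notMem_tsupport hy) hx
  have hts : ∀ k, tsupport (φ k) ⊆ Metric.cthickening δ (tsupport ψ) := fun k =>
    closure_minimal (fun x hx => by
      by_contra h
      exact hx (hzero k x h)) Metric.isClosed_cthickening
  have hKsub : ∀ x ∉ Metric.cthickening δ (tsupport ψ), x ∉ tsupport ψ := fun x hx h =>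
    hx (Metric.self_subset_cthickening _ h)
  refine ⟨φ, fun k => ⟨hsmooth k, hcpt.of_isClosed_subset (isClosed_tsupport _) (hts k),
    (hts k).trans hδV⟩, ?_, ?_⟩
  · obtain ⟨B, hB⟩ := hc.exists_bound_of_continuous hK.continuous
    refine tendsto_eLpNorm_zero_of_bounded
      (fun k => ((hsmooth k).continuous.sub hK.continuous).aestronglyMeasurable) hcpt
      (fun k x hx => ?_) (c := B + B) (fun k x => ?_) (Eventually.of_forall fun x => ?_)
    · rw [hzero k x hx, image_eq_zero_of_notMem_tsupport (hKsub x hx), sub_zero]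
    · exact (norm_sub_le _ _).trans (add_le_add (norm_normed_convolution_le _ hB x) (hB x))
    · rw [← sub_self (ψ x)]
      exact (ContDiffBump.convolution_tendsto_right_of_continuous hblim hK.continuous x).sub_const _
  · refine tendsto_eLpNorm_zero_of_bounded
      (fun k => ((measurable_gradient _).sub (measurable_gradient _)).aestronglyMeasurable) hcpt
      (fun k x hx => ?_) (c := K + K) (fun k x => ?_) ?_
    · rw [gradient_normed_convolution (b k) hψ, normed_convolution_eq_zero (b k) (hbδ k)
        (fun y hy => gradient_eq_zero_of_notMem_tsupport hy) hx,
        gradient_eq_zero_of_notMem_tsupport (hKsub x hx), sub_zero]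
    · rw [gradient_normed_convolution (b k) hψ]
      exact (norm_sub_le _ _).trans (add_le_add
        (norm_normed_convolution_le _ (norm_gradient_le hK) x) (norm_gradient_le hK x))
    -- The gradient of `ψ` is merely bounded, so its mollifications converge only almost everywhere,
    -- by Lebesgue differentiation. The value `K = 2` is the ratio of the outer to the inner radius
    -- of the bumps.
    · have := ContDiffBump.ae_convolution_tendsto_right_of_locallyIntegrable (φ := b) (l := atTop)
        (K := 2) hblim (Eventually.of_forall fun k => by
          simp only [b]; linarith) hloc
      filter_upwards [this] with x hx
      simp only [fun k => gradient_normed_convolution (b k) hψ x, φ]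
      simpa using hx.sub_const (gradient ψ x)

end Mollification

/-! ### Existence and bounds for a fixed geometry -/

section Deterministic

variable {n : ℕ} {M S V : Set (E n)} {κ cB ρ : ℝ} {W : E n → ℝ}

lemma integral_norm_le_norm_mul_sqrt {F X : Type*} [NormedAddCommGroup F] [MeasurableSpace X]
    {μ : Measure X} [IsFiniteMeasure μ] (f : Lp F 2 μ) :
    ∫ x, ‖f x‖ ∂μ ≤ ‖f‖ * √(μ.real Set.univ) := by
  have h1 : MemLp (fun x => ‖f x‖) 2 μ := (Lp.memLp f).norm
  have h2 : MemLp (fun _ : X => (1 : ℝ)) 2 μ := memLp_const 1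
  have h3 : inner ℝ (h1.toLp _) (h2.toLp _) = ∫ x, ‖f x‖ ∂μ := by
    rw [inner_eq_integral h1.coeFn_toLp h2.coeFn_toLp]
    simp
  have h4 : ‖h2.toLp _‖ = √(μ.real Set.univ) := by
    rw [← Real.sqrt_sq (norm_nonneg _), ← real_inner_self_eq_norm_sq,
      inner_eq_integral h2.coeFn_toLp h2.coeFn_toLp]
    simp
  have h5 : ‖h1.toLp _‖ ≤ ‖f‖ := by
    apply Lp.norm_le_norm_of_ae_le
    filter_upwards [h1.coeFn_toLp] with x hx
    rw [hx, norm_norm]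
  rw [← h3, ← h4]
  exact (real_inner_le_norm _ _).trans (by gcongr)

lemma lipschitzTest.max_zero {ψ : E n → ℝ} (hψ : ψ ∈ lipschitzTest V) :
    (fun x => max (ψ x) 0) ∈ lipschitzTest V := by
  have := max_add_mem_lipschitzTest hψ (LipschitzWith.const 0) (fun _ => le_rfl)
  simpa using this

/-- The integral over the fluid that bounds the boundary integral of a test function. -/
def traceBound (M V : Set (E n)) (κ : ℝ) (W ψ : E n → ℝ) : ℝ :=
  ∫ x in V \ closure M, (κ * ψ x - inner ℝ (gradient W x) (gradient ψ x))

lemma IsBarrier.integral_le (hW : IsBarrier M S κ cB ρ W) (hcB : 0 ≤ cB) {ψ : E n → ℝ}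
    (hψ : ψ ∈ lipschitzTest V) (hψ0 : 0 ≤ ψ) :
    0 ≤ traceBound M V κ W ψ ∧ Integrable ψ ((surfaceMeasure n).restrict S) ∧
      ∫ x in S, ψ x ∂surfaceMeasure n ≤ cB * traceBound M V κ W ψ := by
  obtain ⟨⟨K, hK⟩, hc, hs⟩ := id hψ
  obtain ⟨h0, h1⟩ := hW.trace ψ K hK hc hψ0
  have heq : traceBound M V κ W ψ =
      ∫ x in (closure M)ᶜ, (κ * ψ x - inner ℝ (gradient W x) (gradient ψ x)) := by
    symm
    refine setIntegral_eq_of_subset_of_forall_sdiff_eq_zero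
      isClosed_closure.measurableSet.compl (fun x hx => hx.2) ?_
    intro x hx
    have hxV : x ∉ tsupport ψ := fun h => hx.2 ⟨hs h, hx.1⟩
    simp [image_eq_zero_of_notMem_tsupport hxV, gradient_eq_zero_of_notMem_tsupport hxV]
  rw [← heq] at h0 h1
  have hm := hK.continuous.aestronglyMeasurable (μ := (surfaceMeasure n).restrict S)
  refine ⟨h0, ⟨hm, ?_⟩, ?_⟩
  · rw [hasFiniteIntegral_iff_ofReal (Eventually.of_forall hψ0)]
    exact h1.trans_lt ENNReal.ofReal_lt_top
  · rw [integral_eq_lintegral_of_nonneg_ae (Eventually.of_forall hψ0) hm]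
    exact ENNReal.toReal_le_of_le_ofReal (by positivity) h1

/-- Cauchy-Schwarz against the constant one, with `|∇W| ≤ 1` and `|∇ψ⁺| ≤ |∇ψ|`. The square root of
the volume arises here. -/
lemma traceBound_max_zero_le (hW : IsBarrier M S κ cB ρ W) (hV : volume V ≠ ⊤)
    (hκ : 0 ≤ κ) (ψ : lipschitzTest V) :
    traceBound M V κ W (fun x => max (ψ.1 x) 0) ≤ (κ + 1) * √(volume.real (V \ closure M)) *
      ‖lipschitzEmbedding (V \ closure M) V ψ‖ := by
  set U := V \ closure M with hU
  have hUfin : volume U ≠ ⊤ := measure_ne_top_of_subset Set.sdiff_subset hV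
  have : IsFiniteMeasure (volume.restrict U) := isFiniteMeasure_restrict.2 hUfin
  set e := lipschitzEmbedding U V ψ
  have hi1 : Integrable (fun x => ‖ψ.1 x‖) (volume.restrict U) :=
    (memLp_one_iff_integrable.1 (lipschitzTest.memLp ψ.2 1)).norm.restrict
  have hi2 : Integrable (fun x => ‖gradient ψ.1 x‖) (volume.restrict U) :=
    (memLp_one_iff_integrable.1 (lipschitzTest.memLp_gradient ψ.2 1)).norm.restrict
  have hi3 : Integrable (fun x => max (ψ.1 x) 0) (volume.restrict U) :=
    (memLp_one_iff_integrable.1 (lipschitzTest.memLp (lipschitzTest.max_zero ψ.2) 1)).restrict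
  have hi4 : Integrable (fun x => inner ℝ (gradient W x) (gradient (fun x => max (ψ.1 x) 0) x))
      (volume.restrict U) := by
    have h2 := (memLp_one_iff_integrable.1
      (lipschitzTest.memLp_gradient (lipschitzTest.max_zero ψ.2) 1)).restrict (s := U)
    refine h2.norm.mono' ((measurable_gradient W).inner
      (measurable_gradient _)).aestronglyMeasurable (Eventually.of_forall fun x => ?_)
    refine (norm_inner_le_norm _ _).trans (mul_le_of_le_one_left (norm_nonneg _) ?_)
    exact norm_gradient_le hW.lipschitz x
  have h1 : ∫ x in U, ‖ψ.1 x‖ ≤ ‖e‖ * √(volume.real U) := by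
    have := integral_norm_le_norm_mul_sqrt e.fst
    rw [measureReal_restrict_apply_univ] at this
    refine le_trans (le_of_eq ?_) (this.trans (mul_le_mul_of_nonneg_right
      (WithLp.norm_fst_le (p := 2) _ e) (Real.sqrt_nonneg _)))
    refine integral_congr_ae ?_
    filter_upwards [lipschitzEmbedding_fst (U := U) ψ] with x hx
    rw [hx]
  have h2 : ∫ x in U, ‖gradient ψ.1 x‖ ≤ ‖e‖ * √(volume.real U) := by
    have := integral_norm_le_norm_mul_sqrt e.snd
    rw [measureReal_restrict_apply_univ] at this
    refine le_trans (le_of_eq ?_) (this.trans (mul_le_mul_of_nonneg_right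
      (WithLp.norm_snd_le (p := 2) _ e) (Real.sqrt_nonneg _)))
    refine integral_congr_ae ?_
    filter_upwards [lipschitzEmbedding_snd (U := U) ψ] with x hx
    rw [hx]
  calc traceBound M V κ W (fun x => max (ψ.1 x) 0)
      ≤ ∫ x in U, (κ * ‖ψ.1 x‖ + ‖gradient ψ.1 x‖) := by
        refine integral_mono ((hi3.const_mul κ).sub hi4) ((hi1.const_mul κ).add hi2) fun x => ?_
        have e1 : max (ψ.1 x) 0 ≤ ‖ψ.1 x‖ := max_le (le_abs_self _) (norm_nonneg _)
        have e2 := inner_gradient_gradient_max_zero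
          (lipschitzTest.continuous ψ.2).continuousAt (x := x)
        have e3 := real_inner_le_norm (gradient ψ.1 x) (gradient (fun x => max (ψ.1 x) 0) x)
        have e4 : ‖gradient (fun x => max (ψ.1 x) 0) x‖ ≤ ‖gradient ψ.1 x‖ := by
          rw [e2, sq] at e3
          by_contra! hc
          exact absurd e3 (not_le.2 (mul_lt_mul_of_pos_right hc ((norm_nonneg _).trans_lt hc)))
        have e5 := abs_real_inner_le_norm (gradient W x) (gradient (fun x => max (ψ.1 x) 0) x)
        have e6 : ‖gradient W x‖ ≤ 1 := norm_gradient_le hW.lipschitz x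
        have e7 := mul_le_mul e6 e4 (norm_nonneg _) zero_le_one
        have e8 := (abs_le.1 e5).1
        have e9 := mul_le_mul_of_nonneg_left e1 hκ
        simp only
        linarith
    _ = κ * (∫ x in U, ‖ψ.1 x‖) + ∫ x in U, ‖gradient ψ.1 x‖ := by
        rw [integral_add (hi1.const_mul κ) hi2, integral_const_mul]
    _ ≤ κ * (‖e‖ * √(volume.real U)) + ‖e‖ * √(volume.real U) := by gcongr
    _ = _ := by ring


variable {σ : E n → ℝ} {C₀ : ℝ}

lemma integrable_mul_surfaceMeasure (hW : IsBarrier M S κ cB ρ W) (hcB : 0 ≤ cB)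
    (hσm : AEStronglyMeasurable σ ((surfaceMeasure n).restrict S))
    (hσ : ∀ᵐ x ∂(surfaceMeasure n).restrict S, |σ x| ≤ C₀) {ψ : E n → ℝ}
    (hψ : ψ ∈ lipschitzTest V) : Integrable (fun x => σ x * ψ x) ((surfaceMeasure n).restrict S) := by
  have h1 := (hW.integral_le hcB (lipschitzTest.max_zero hψ) (fun x => le_max_right _ _)).2.1
  have h2 := (hW.integral_le hcB (lipschitzTest.max_zero (Submodule.neg_mem _ hψ)) (fun x => le_max_right _ _)).2.1
  have h3 : Integrable ψ ((surfaceMeasure n).restrict S) := by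
    refine (h1.sub h2).congr (Eventually.of_forall fun x => ?_)
    simp only [Pi.sub_apply, Pi.neg_apply]
    rcases le_total 0 (ψ x) with h | h
    · rw [max_eq_left h, max_eq_right (by linarith)]; ring
    · rw [max_eq_right h, max_eq_left (by linarith)]; ring
  exact h3.bdd_mul hσm hσ

lemma abs_integral_mul_surfaceMeasure_le (hW : IsBarrier M S κ cB ρ W) (hcB : 0 ≤ cB)
    (hσ : ∀ᵐ x ∂(surfaceMeasure n).restrict S, |σ x| ≤ C₀) {ψ : E n → ℝ}
    (hψ : ψ ∈ lipschitzTest V) (hψ0 : 0 ≤ ψ) :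
    |∫ x in S, σ x * ψ x ∂surfaceMeasure n| ≤ |C₀| * cB * traceBound M V κ W ψ := by
  obtain ⟨-, h1, h2⟩ := hW.integral_le hcB hψ hψ0
  have h3 : |∫ x in S, σ x * ψ x ∂surfaceMeasure n| ≤
      ∫ x in S, |C₀| * ψ x ∂surfaceMeasure n := by
    rw [← Real.norm_eq_abs]
    refine norm_integral_le_of_norm_le (h1.const_mul _) ?_
    filter_upwards [hσ] with x hx
    rw [norm_mul, Real.norm_of_nonneg (hψ0 x)]
    exact mul_le_mul_of_nonneg_right (hx.trans (le_abs_self _)) (hψ0 x)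
  rw [integral_const_mul] at h3
  refine h3.trans ?_
  rw [mul_assoc]
  gcongr

/-- Existence for the semilinear problem with a strongly monotone nonlinearity, with bounds for
the energy and the supremum. -/
theorem exists_bounded_solution (hV : volume V ≠ ⊤)
    (hW : IsBarrier M S κ cB ρ W) (hκ : 0 ≤ κ) (hcB : 0 ≤ cB)
    (hσm : AEStronglyMeasurable σ ((surfaceMeasure n).restrict S))
    (hσ : ∀ᵐ x ∂(surfaceMeasure n).restrict S, |σ x| ≤ C₀) (Nσ : ℝ)
    {h : ℝ → ℝ} {K : NNReal} {c : ℝ}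
    (hK : LipschitzWith K h) (h0 : h 0 = 0) (hc : 0 < c) (hc1 : c ≤ 1)
    (hmono : ∀ s t, c * (s - t) ^ 2 ≤ (h s - h t) * (s - t)) :
    ∃ u ∈ h1Space (V \ closure M) V,
      c * ‖u‖ ≤ 2 * (|Nσ| * (|C₀| * cB)) * (κ + 1) * √(volume.real (V \ closure M)) ∧
      (∀ᵐ x ∂volume.restrict (V \ closure M),
        |u.fst x| ≤ |Nσ| * (|C₀| * cB) * κ / c + |Nσ| * (|C₀| * cB) * ρ) ∧
      ∀ ψ, inner ℝ u.snd (lipschitzEmbedding (V \ closure M) V ψ).snd +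
        inner ℝ (hK.compLp h0 u.fst) (lipschitzEmbedding (V \ closure M) V ψ).fst =
          -(Nσ * ∫ x in S, σ x * ψ.1 x ∂surfaceMeasure n) := by
  set U := V \ closure M with hU
  set A := |Nσ| * (|C₀| * cB) with hA
  have hA0 : 0 ≤ A := by positivity
  have hUfin : volume U ≠ ⊤ := measure_ne_top_of_subset Set.sdiff_subset hV
  have hint := fun ψ : lipschitzTest V => integrable_mul_surfaceMeasure hW hcB hσm hσ ψ.2
  let ℓ : lipschitzTest V →ₗ[ℝ] ℝ :=
    { toFun := fun ψ => -(Nσ * ∫ x in S, σ x * ψ.1 x ∂surfaceMeasure n)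
      map_add' := fun φ ψ => by
        have : ∀ x, σ x * (φ + ψ).1 x = σ x * φ.1 x + σ x * ψ.1 x := fun x => by
          simp [mul_add]
        simp only [this]
        rw [integral_add (hint φ) (hint ψ)]
        ring
      map_smul' := fun a ψ => by
        have : ∀ x, σ x * (a • ψ).1 x = a * (σ x * ψ.1 x) := fun x => by
          simp; ring
        simp only [this, integral_const_mul, RingHom.id_apply, smul_eq_mul]
        ring }
  have hℓ0 : ∀ ψ : lipschitzTest V, 0 ≤ ψ.1 → |ℓ ψ| ≤ A * traceBound M V κ W ψ.1 := by
    intro ψ hψ0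
    change |-(Nσ * _)| ≤ _
    rw [abs_neg, abs_mul, hA, mul_assoc]
    gcongr
    exact abs_integral_mul_surfaceMeasure_le hW hcB hσ ψ.2 hψ0
  -- The trace inequality holds only for nonnegative functions, so `ψ` is split into positive and
  -- negative parts; hence the factor `2`.
  have hℓ : ∀ ψ, |ℓ ψ| ≤ 2 * A * (κ + 1) * √(volume.real U) * ‖lipschitzEmbedding U V ψ‖ := by
    intro ψ
    have hψ : ψ = ⟨_, lipschitzTest.max_zero ψ.2⟩ - ⟨_, lipschitzTest.max_zero (-ψ).2⟩ := by
      ext x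
      simp only [Submodule.coe_sub, Pi.sub_apply, Submodule.coe_neg, Pi.neg_apply]
      rcases le_total 0 (ψ.1 x) with h | h
      · rw [max_eq_left h, max_eq_right (by linarith)]; ring
      · rw [max_eq_right h, max_eq_left (by linarith)]; ring
    have e1 := hℓ0 ⟨_, lipschitzTest.max_zero ψ.2⟩ (fun x => le_max_right _ _)
    have e2 := hℓ0 ⟨_, lipschitzTest.max_zero (-ψ).2⟩ (fun x => le_max_right _ _)
    have e3 := mul_le_mul_of_nonneg_left (traceBound_max_zero_le hW hV hκ ψ) hA0
    have e4 := mul_le_mul_of_nonneg_left (traceBound_max_zero_le hW hV hκ (-ψ)) hA0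
    rw [map_neg, norm_neg] at e4
    have e5 : |ℓ ψ| ≤ |ℓ ⟨_, lipschitzTest.max_zero ψ.2⟩| + |ℓ ⟨_, lipschitzTest.max_zero (-ψ).2⟩| := by
      conv_lhs => rw [hψ, map_sub]
      exact abs_sub _ _
    refine e5.trans ((add_le_add (e1.trans e3) (e2.trans e4)).trans_eq ?_)
    ring
  obtain ⟨u, hu, hunorm, hueq⟩ := exists_mem_h1Space_of_strongly_monotone (U := U) hK h0 hc hc1
    hmono ℓ (by positivity) hℓ
  -- Strong monotonicity and `h 0 = 0` give `|h s| ≥ c |s|`. The threshold `A κ / c`, and with it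
  -- the supremum bound, sees `h` only through `c`.
  have hgrow : ∀ s, A * κ / c < s → A * κ < h s ∧ A * κ < -h (-s) := by
    intro s hs
    have hs0 : 0 < s := lt_of_le_of_lt (by positivity) hs
    rw [div_lt_iff₀ hc] at hs
    have h1 := hmono s 0
    have h2 := hmono (-s) 0
    rw [h0] at h1 h2
    simp only [sub_zero] at h1 h2
    have h3 : s * c ≤ h s := le_of_mul_le_mul_right (by linarith) hs0
    have h4 : s * c ≤ -h (-s) := le_of_mul_le_mul_right (by linarith) hs0
    exact ⟨by linarith, by linarith⟩
  have hm : 0 ≤ A * κ / c := by positivity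
  have hup := ae_le_of_subsolution hu hUfin hK h0 hW.lipschitz hW.le hW.nonneg hA0 hm
    (fun s hs => (hgrow s hs).1) (fun ψ hψ0 => by
      rw [hueq]
      exact (le_abs_self _).trans (hℓ0 ψ hψ0))
  -- The lower bound is the upper bound for `-u`, which satisfies the equation with the reflected
  -- nonlinearity and the opposite charge.
  have hK' : LipschitzWith K fun s => -h (-s) := by
    have := hK.neg.comp (LipschitzWith.id.neg (α := ℝ))
    simpa [Function.comp_def] using! this
  have h0' : (fun s => -h (-s)) 0 = 0 := by simp [h0]
  have hcomp : hK'.compLp h0' (-u).fst = -(hK.compLp h0 u.fst) := by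
    have hneg : (-u).fst = -u.fst := rfl
    rw [hneg, Lp.ext_iff]
    filter_upwards [hK'.coeFn_compLp h0' (-u.fst), hK.coeFn_compLp h0 u.fst, Lp.coeFn_neg u.fst,
      Lp.coeFn_neg (hK.compLp h0 u.fst)] with x e1 e2 e3 e4
    rw [e1, e4, Pi.neg_apply, e2, Function.comp, e3]
    simp
  have hlow := ae_le_of_subsolution (Submodule.neg_mem _ hu) hUfin hK' h0' hW.lipschitz hW.le
    hW.nonneg hA0 hm (fun s hs => (hgrow s hs).2) (fun ψ hψ0 => by
      rw [hcomp]
      have hneg : (-u).snd = -u.snd := rfl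
      rw [hneg, inner_neg_left, inner_neg_left, ← neg_add, hueq]
      exact (neg_le_abs _).trans (hℓ0 ψ hψ0))
  refine ⟨u, hu, hunorm, ?_, hueq⟩
  have hneg : (-u).fst = -u.fst := rfl
  rw [hneg] at hlow
  filter_upwards [hup, hlow, Lp.coeFn_neg u.fst] with x e1 e2 e3
  rw [e3, Pi.neg_apply] at e2
  exact abs_le.2 ⟨by linarith, e1⟩

end Deterministic

/-! ### Monotonicity and truncation of the nonlinearity -/

section ChargeDensity

variable {N : ℕ} {z : Fin (N + 1) → ℤ} {nc : Fin (N + 1) → ℝ}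

lemma chargeDensity_zero (hneutral : ∑ j, (z j : ℝ) * nc j = 0) : chargeDensity z nc 0 = 0 := by
  simpa [chargeDensity] using hneutral

lemma hasDerivAt_chargeDensity {m : ℕ} (z : Fin m → ℤ) (nc : Fin m → ℝ) (s : ℝ) :
    HasDerivAt (chargeDensity z nc) (-∑ j, (z j : ℝ) ^ 2 * nc j * Real.exp (-(z j : ℝ) * s)) s := by
  rw [← Finset.sum_neg_distrib]
  refine HasDerivAt.fun_sum fun j _ => ?_
  have h1 : HasDerivAt (fun s : ℝ => -(z j : ℝ) * s) (-(z j : ℝ)) s := by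
    simpa using (hasDerivAt_id s).const_mul (-(z j : ℝ))
  refine (h1.exp.const_mul ((z j : ℝ) * nc j)).congr_deriv ?_
  ring

lemma contDiff_chargeDensity {m : ℕ} (z : Fin m → ℤ) (nc : Fin m → ℝ) :
    ContDiff ℝ 1 (chargeDensity z nc) := by
  unfold chargeDensity
  fun_prop

/-- The charge density is strongly decreasing. -/
lemma exists_monotone_neg_chargeDensity (hz_neg : z 0 < 0)
    (hz_pos : 0 < z (Fin.last N)) (hnc : ∀ j, 0 < nc j) {β : ℝ} (hβ : 0 < β) :
    ∃ c, 0 < c ∧ c ≤ 1 ∧ Monotone fun s => -β * chargeDensity z nc s - c * s := by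
  set a := min ((z 0 : ℝ) ^ 2 * nc 0) ((z (Fin.last N) : ℝ) ^ 2 * nc (Fin.last N)) with ha
  have hz0 : (z 0 : ℝ) < 0 := by exact_mod_cast hz_neg
  have hzN : (0 : ℝ) < z (Fin.last N) := by exact_mod_cast hz_pos
  have := hz0.ne
  have ha0 : 0 < a := lt_min (mul_pos (by positivity) (hnc _)) (mul_pos (by positivity) (hnc _))
  refine ⟨min 1 (β * a), lt_min one_pos (by positivity), min_le_left _ _, ?_⟩
  have hd : ∀ s, HasDerivAt (fun s => -β * chargeDensity z nc s - min 1 (β * a) * s)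
      (β * (∑ j, (z j : ℝ) ^ 2 * nc j * Real.exp (-(z j : ℝ) * s)) - min 1 (β * a)) s := by
    intro s
    refine (((hasDerivAt_chargeDensity z nc s).const_mul (-β)).sub
      ((hasDerivAt_id s).const_mul _)).congr_deriv ?_
    ring
  refine monotone_of_deriv_nonneg (fun s => (hd s).differentiableAt) fun s => ?_
  rw [(hd s).deriv, sub_nonneg]
  refine (min_le_right _ _).trans (mul_le_mul_of_nonneg_left ?_ hβ.le)
  have hterm : ∀ j, (z j : ℝ) ^ 2 * nc j * Real.exp (-(z j : ℝ) * s) ≤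
      ∑ j, (z j : ℝ) ^ 2 * nc j * Real.exp (-(z j : ℝ) * s) := fun j =>
    Finset.single_le_sum (f := fun j => (z j : ℝ) ^ 2 * nc j * Real.exp (-(z j : ℝ) * s))
      (fun i _ => by have := hnc i; positivity) (Finset.mem_univ j)
  have hone : ∀ j, 0 ≤ -(z j : ℝ) * s → (z j : ℝ) ^ 2 * nc j ≤
      ∑ j, (z j : ℝ) ^ 2 * nc j * Real.exp (-(z j : ℝ) * s) := fun j hj =>
    (le_mul_of_one_le_right (by have := hnc j; positivity) (Real.one_le_exp hj)).trans (hterm j)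
  -- For `s ≥ 0` the exponential of the most negative ion is at least one, for `s ≤ 0` that of the
  -- most positive ion.
  rcases le_total 0 s with hs | hs
  · exact (min_le_left _ _).trans (hone 0 (mul_nonneg (by linarith) hs))
  · exact (min_le_right _ _).trans (hone _ (mul_nonneg_of_nonpos_of_nonpos (by linarith) hs))

/-- A globally Lipschitz, strongly monotone function that agrees with `f` on an interval. -/
lemma exists_truncation {f : ℝ → ℝ} (hf : ContDiff ℝ 1 f) (hf0 : f 0 = 0) {c : ℝ}
    (hmono : Monotone fun s => f s - c * s) {Λ : ℝ} (hΛ : 0 ≤ Λ) :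
    ∃ (K : NNReal) (h : ℝ → ℝ), LipschitzWith K h ∧ h 0 = 0 ∧
      (∀ s t, c * (s - t) ^ 2 ≤ (h s - h t) * (s - t)) ∧ ∀ s, |s| ≤ Λ → h s = f s := by
  let clamp : ℝ → ℝ := fun s => max (-Λ) (min s Λ)
  have hclamp : LipschitzWith 1 clamp := (LipschitzWith.id.min_const Λ).const_max (-Λ)
  have hmem : ∀ s, clamp s ∈ Set.Icc (-Λ) Λ := fun s =>
    ⟨le_max_left _ _, max_le (by linarith) (min_le_right _ _)⟩
  have heq : ∀ s, |s| ≤ Λ → clamp s = s := fun s hs => by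
    obtain ⟨h1, h2⟩ := abs_le.1 hs
    simp only [clamp]
    rw [min_eq_left h2, max_eq_right h1]
  have hcm : Monotone clamp := fun s t hst => max_le_max le_rfl (min_le_min hst le_rfl)
  have hk : ContDiff ℝ 1 fun s => f s - c * s := by fun_prop
  obtain ⟨K, hK⟩ := hk.contDiffOn.exists_lipschitzOnWith (s := Set.Icc (-Λ) Λ) one_ne_zero
    (convex_Icc _ _) isCompact_Icc
  -- Only the monotone remainder `f s - c * s` is frozen outside `[-Λ, Λ]`. The linear part is kept,
  -- so the monotonicity constant stays exactly `c`.
  refine ⟨‖c‖₊ * 1 + K * 1, fun s => c • s + (f (clamp s) - c * clamp s), ?_, ?_, ?_, ?_⟩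
  · refine ((lipschitzWith_smul c).comp LipschitzWith.id).add ?_
    intro s t
    have h1 := hK (hmem s) (hmem t)
    refine h1.trans ?_
    rw [ENNReal.coe_mul, mul_assoc]
    gcongr
    exact hclamp s t
  · beta_reduce
    rw [heq 0 (by simpa using hΛ)]
    simp [hf0]
  · intro s t
    have : 0 ≤ ((f (clamp s) - c * clamp s) - (f (clamp t) - c * clamp t)) * (s - t) := by
      rcases le_total s t with h | h
      · exact mul_nonneg_of_nonpos_of_nonpos (sub_nonpos.2 (hmono (hcm h))) (by linarith)
      · exact mul_nonneg (sub_nonneg.2 (hmono (hcm h))) (by linarith)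
    simp only [smul_eq_mul]
    linarith
  · intro s hs
    beta_reduce
    rw [heq s hs, smul_eq_mul]
    ring

end ChargeDensity

/-! ### From the energy space to weak gradients and boundary values -/

section WeakFormulation

variable {n : ℕ} {U V : Set (E n)}

lemma IsTestFunction.mem_lipschitzTest {φ : E n → ℝ} (hφ : IsTestFunction V φ) :
    φ ∈ lipschitzTest V :=
  ⟨hφ.contDiff.lipschitzWith_of_hasCompactSupport hφ.hasCompactSupport (by simp) ,
    hφ.hasCompactSupport, hφ.tsupport_subset⟩

lemma integrable_inner_of_memLp {X F : Type*} [MeasurableSpace X] {μ : Measure X}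
    [NormedAddCommGroup F] [InnerProductSpace ℝ F] {f g : X → F} (hf : MemLp f 2 μ)
    (hg : MemLp g 2 μ) : Integrable (fun x => inner ℝ (f x) (g x)) μ := by
  refine (L2.integrable_inner (𝕜 := ℝ) (hf.toLp f) (hg.toLp g)).congr ?_
  filter_upwards [hf.coeFn_toLp, hg.coeFn_toLp] with x h1 h2
  rw [h1, h2]

lemma integral_mul_inner_gradient_add (φ : E n → ℝ) (hφ : IsTestFunction U φ)
    (ψ : lipschitzTest V) (v : E n) :
    (∫ x in U, ψ.1 x * inner ℝ (gradient φ x) v) + ∫ x in U, inner ℝ (gradient ψ.1 x) (φ x • v)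
      = 0 := by
  obtain ⟨⟨K, hK⟩, -⟩ := ψ.2
  obtain ⟨⟨L, hL⟩, hc, hs⟩ := hφ.mem_lipschitzTest
  have h := hK.integral_lineDeriv_mul_eq (μ := volume) hL hc v
  have hdφ : Differentiable ℝ φ := hφ.contDiff.differentiable (by simp)
  have hU : ∀ x ∉ U, x ∉ tsupport φ := fun x hx h => hx (hs h)
  rw [setIntegral_eq_integral_of_forall_compl_eq_zero
      (fun x hx => by rw [gradient_eq_zero_of_notMem_tsupport (hU x hx)]; simp),
    setIntegral_eq_integral_of_forall_compl_eq_zero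
      (fun x hx => by rw [image_eq_zero_of_notMem_tsupport (hU x hx)]; simp)]
  have e1 : ∫ x, inner ℝ (gradient ψ.1 x) (φ x • v) = ∫ x, lineDeriv ℝ ψ.1 x v * φ x := by
    refine integral_congr_ae ?_
    filter_upwards [hK.ae_differentiableAt] with x hx
    rw [inner_smul_right, inner_gradient_eq_lineDeriv hx, mul_comm]
  have e2 : ∫ x, ψ.1 x * inner ℝ (gradient φ x) v = -∫ x, lineDeriv ℝ φ x (-v) * ψ.1 x := by
    rw [← integral_neg]
    congr 1
    ext x
    rw [lineDeriv_neg, inner_gradient_eq_lineDeriv (hdφ x)]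
    ring
  rw [e1, e2, h, neg_add_cancel]

/-- Integration by parts holds for Lipschitz functions and passes to `L²` limits. The vector
identity is checked against each fixed direction `v`. -/
theorem memH1_of_mem_h1Space {u : H1Ambient U} (hu : u ∈ h1Space U V) :
    MemH1 U u.fst u.snd := by
  refine ⟨Lp.memLp _, Lp.memLp _, fun φ hφ => ?_⟩
  obtain ⟨ψ, hψ⟩ := tendsto_lipschitzEmbedding_of_mem hu
  have hgφ : MemLp (gradient φ) 2 (volume.restrict U) :=
    (lipschitzTest.memLp_gradient hφ.mem_lipschitzTest 2).restrict U
  have hφ2 : MemLp φ 2 (volume.restrict U) := (lipschitzTest.memLp hφ.mem_lipschitzTest 2).restrict U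
  have hv : ∀ v : E n, (∫ x in U, inner ℝ (u.fst x) (inner ℝ (gradient φ x) v)) +
      ∫ x in U, inner ℝ (u.snd x) (φ x • v) = 0 := by
    intro v
    have h1 : MemLp (fun x => inner ℝ (gradient φ x) v) 2 (volume.restrict U) :=
      hgφ.inner_const v
    have h2 : MemLp (fun x => φ x • v) 2 (volume.restrict U) := by
      refine hφ2.of_le_mul (c := ‖v‖) (hφ2.aestronglyMeasurable.smul_const v)
        (Eventually.of_forall fun x => ?_)
      rw [norm_smul, mul_comm]
    have hlim : Tendsto (fun k => inner ℝ (lipschitzEmbedding U V (ψ k)).fst (h1.toLp _) +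
        inner ℝ (lipschitzEmbedding U V (ψ k)).snd (h2.toLp _)) atTop
        (𝓝 (inner ℝ u.fst (h1.toLp _) + inner ℝ u.snd (h2.toLp _))) :=
      ((((WithLp.continuous_fst 2 _ _).tendsto _).comp hψ).inner tendsto_const_nhds).add
        ((((WithLp.continuous_snd 2 _ _).tendsto _).comp hψ).inner tendsto_const_nhds)
    have hz : ∀ k, inner ℝ (lipschitzEmbedding U V (ψ k)).fst (h1.toLp _) +
        inner ℝ (lipschitzEmbedding U V (ψ k)).snd (h2.toLp _) = 0 := by
      intro k
      rw [inner_eq_integral (lipschitzEmbedding_fst (ψ k)) h1.coeFn_toLp,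
        inner_eq_integral (lipschitzEmbedding_snd (ψ k)) h2.coeFn_toLp,
        ← integral_mul_inner_gradient_add φ hφ (ψ k) v]
      congr 1
      refine integral_congr_ae (Eventually.of_forall fun x => ?_)
      simp [mul_comm]
    simp only [hz] at hlim
    rw [← inner_eq_integral (f := u.fst) (EventuallyEq.refl _ _) h1.coeFn_toLp,
      ← inner_eq_integral (f := u.snd) (EventuallyEq.refl _ _) h2.coeFn_toLp]
    exact (tendsto_nhds_unique hlim tendsto_const_nhds)
  have hi1 : Integrable (fun x => u.fst x • gradient φ x) (volume.restrict U) := by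
    rw [← memLp_one_iff_integrable]
    exact hgφ.smul (Lp.memLp u.fst) (hpqr := ⟨by simp [ENNReal.inv_two_add_inv_two]⟩)
  have hi2 : Integrable (fun x => φ x • u.snd x) (volume.restrict U) := by
    rw [← memLp_one_iff_integrable]
    exact (Lp.memLp u.snd).smul hφ2
  refine ext_inner_right ℝ fun v => ?_
  rw [inner_neg_left, real_inner_comm, ← integral_inner hi1, real_inner_comm,
    ← integral_inner hi2]
  have := hv v
  rw [← eq_neg_iff_add_eq_zero] at this
  have e1 : ∫ x in U, inner ℝ v (u.fst x • gradient φ x) =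
      ∫ x in U, inner ℝ (u.fst x) (inner ℝ (gradient φ x) v) := by
    refine integral_congr_ae (Eventually.of_forall fun x => ?_)
    simp only [inner_smul_right, real_inner_comm (gradient φ x) v]
    simp [mul_comm]
  have e2 : ∫ x in U, inner ℝ v (φ x • u.snd x) = ∫ x in U, inner ℝ (u.snd x) (φ x • v) := by
    refine integral_congr_ae (Eventually.of_forall fun x => ?_)
    simp only [inner_smul_right, real_inner_comm v]
  rw [e1, e2, this]

/-- Diagonal choice: the `k`-th Lipschitz approximation is replaced by a smooth one at distance at
most `1 / (k + 1)`. -/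
theorem vanishesOnOuterBoundary_of_mem_h1Space (hV : IsOpen V) {u : H1Ambient U}
    (hu : u ∈ h1Space U V) : VanishesOnOuterBoundary U V u.fst u.snd := by
  obtain ⟨ψ, hψ⟩ := tendsto_lipschitzEmbedding_of_mem hu
  have hsm : ∀ k : ℕ, ∃ φ, IsTestFunction V φ ∧
      eLpNorm (fun x => φ x - (ψ k).1 x) 2 volume ≤ ENNReal.ofReal (1 / (k + 1)) ∧
      eLpNorm (fun x => gradient φ x - gradient (ψ k).1 x) 2 volume ≤
        ENNReal.ofReal (1 / (k + 1)) := by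
    intro k
    obtain ⟨φ, h1, h2, h3⟩ := exists_seq_isTestFunction hV (ψ k).2
    have hpos : 0 < ENNReal.ofReal (1 / ((k : ℝ) + 1)) := ENNReal.ofReal_pos.2 (by positivity)
    obtain ⟨m, hm1, hm2⟩ := ((h2.eventually (ge_mem_nhds hpos)).and
      (h3.eventually (ge_mem_nhds hpos))).exists
    exact ⟨φ m, h1 m, hm1, hm2⟩
  choose φ hφ h1 h2 using hsm
  have hto : Tendsto (fun k : ℕ => ENNReal.ofReal (1 / ((k : ℝ) + 1))) atTop (𝓝 0) := by
    have := ENNReal.tendsto_ofReal (tendsto_one_div_add_atTop_nhds_zero_nat (𝕜 := ℝ))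
    simpa using this
  have hf : Tendsto (fun k => (lipschitzEmbedding U V (ψ k)).fst) atTop (𝓝 u.fst) :=
    ((WithLp.continuous_fst 2 _ _).tendsto _).comp hψ
  have hs : Tendsto (fun k => (lipschitzEmbedding U V (ψ k)).snd) atTop (𝓝 u.snd) :=
    ((WithLp.continuous_snd 2 _ _).tendsto _).comp hψ
  rw [Lp.tendsto_Lp_iff_tendsto_eLpNorm'] at hf hs
  have hf' := hto.add hf
  have hs' := hto.add hs
  rw [zero_add] at hf' hs'
  refine ⟨φ, hφ, tendsto_of_tendsto_of_tendsto_of_le_of_le tendsto_const_nhds hf'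
    (fun _ => zero_le) fun k => ?_, tendsto_of_tendsto_of_tendsto_of_le_of_le
    tendsto_const_nhds hs' (fun _ => zero_le) fun k => ?_⟩
  · have hc := lipschitzTest.continuous (hφ k).mem_lipschitzTest
    have hc' := lipschitzTest.continuous (ψ k).2
    have e1 : (fun x => φ k x - u.fst x) =ᵐ[volume.restrict U]
        (fun x => φ k x - (ψ k).1 x) + (⇑(lipschitzEmbedding U V (ψ k)).fst - ⇑u.fst) := by
      filter_upwards [lipschitzEmbedding_fst (U := U) (ψ k)] with x hx
      simp [hx]
    simp only
    rw [eLpNorm_congr_ae e1]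
    refine (eLpNorm_add_le (hc.sub hc').aestronglyMeasurable
      ((Lp.aestronglyMeasurable _).sub (Lp.aestronglyMeasurable _)) (by norm_num)).trans ?_
    gcongr
    exact (eLpNorm_mono_measure _ Measure.restrict_le_self).trans (h1 k)
  · have e1 : (fun x => gradient (φ k) x - u.snd x) =ᵐ[volume.restrict U]
        (fun x => gradient (φ k) x - gradient (ψ k).1 x) +
          (⇑(lipschitzEmbedding U V (ψ k)).snd - ⇑u.snd) := by
      filter_upwards [lipschitzEmbedding_snd (U := U) (ψ k)] with x hx
      simp [hx]
    simp only
    rw [eLpNorm_congr_ae e1]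
    refine (eLpNorm_add_le
      ((measurable_gradient _).sub (measurable_gradient _)).aestronglyMeasurable
      ((Lp.aestronglyMeasurable _).sub (Lp.aestronglyMeasurable _)) (by norm_num)).trans ?_
    gcongr
    exact (eLpNorm_mono_measure _ Measure.restrict_le_self).trans (h2 k)

end WeakFormulation

/-! ### Uniqueness -/

section Uniqueness

variable {n m : ℕ} {G M : Set (E n)} {ε β Nσ : ℝ} {z : Fin m → ℤ} {nc : Fin m → ℝ} {σ : E n → ℝ}

lemma tendsto_integral_inner {X F : Type*} [MeasurableSpace X] {μ : Measure X}
    [NormedAddCommGroup F] [InnerProductSpace ℝ F] {f g : X → F} {g' : ℕ → X → F}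
    (hf : MemLp f 2 μ) (hg : MemLp g 2 μ) (hg' : ∀ k, MemLp (g' k) 2 μ)
    (h : Tendsto (fun k => eLpNorm (fun x => g' k x - g x) 2 μ) atTop (𝓝 0)) :
    Tendsto (fun k => ∫ x, inner ℝ (f x) (g' k x) ∂μ) atTop (𝓝 (∫ x, inner ℝ (f x) (g x) ∂μ)) := by
  have h1 : Tendsto (fun k => (hg' k).toLp (g' k)) atTop (𝓝 (hg.toLp g)) := by
    rw [Lp.tendsto_Lp_iff_tendsto_eLpNorm'']
    exact h
  have h2 := (tendsto_const_nhds (x := hf.toLp f)).inner h1 (𝕜 := ℝ)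
  rw [inner_eq_integral hf.coeFn_toLp hg.coeFn_toLp] at h2
  refine h2.congr fun k => ?_
  rw [inner_eq_integral hf.coeFn_toLp (hg' k).coeFn_toLp]

lemma memLp_chargeDensity_comp {X : Type*} [MeasurableSpace X] {μ : Measure X} [IsFiniteMeasure μ]
    {u : X → ℝ} (hu : MemLp u ⊤ μ) : MemLp (fun x => chargeDensity z nc (u x)) 2 μ := by
  have hc : Continuous (chargeDensity z nc) := (contDiff_chargeDensity z nc).continuous
  set b := (eLpNorm u ⊤ μ).toReal
  have hb : ∀ᵐ x ∂μ, |u x| ≤ b := by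
    have := ae_le_eLpNormEssSup (f := u) (μ := μ)
    filter_upwards [this] with x hx
    rw [← eLpNorm_exponent_top] at hx
    have := ENNReal.toReal_mono hu.2.ne hx
    rwa [toReal_enorm, Real.norm_eq_abs] at this
  obtain ⟨B, hB⟩ := (isCompact_Icc (a := -b) (b := b)).exists_bound_of_continuousOn hc.continuousOn
  refine MemLp.of_bound (hc.comp_aestronglyMeasurable hu.1) B ?_
  filter_upwards [hb] with x hx
  exact hB _ (abs_le.1 hx)

lemma IsTestFunction.sub {V : Set (E n)} {φ ψ : E n → ℝ} (hφ : IsTestFunction V φ)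
    (hψ : IsTestFunction V ψ) : IsTestFunction V (φ - ψ) :=
  ⟨hφ.contDiff.sub hψ.contDiff, hφ.hasCompactSupport.sub hψ.hasCompactSupport,
    (Submodule.sub_mem _ hφ.mem_lipschitzTest hψ.mem_lipschitzTest).2.2⟩

/-- Two weak solutions of the Poisson-Boltzmann problem agree. -/
theorem IsSolution.ae_eq (hU : volume (rescaledFluidDomain G M ε) ≠ ⊤) {c : ℝ} (hc : 0 < c)
    (hmono : Monotone fun s => -β * chargeDensity z nc s - c * s)
    {u₁ u₂ : E n → ℝ} {g₁ g₂ : E n → E n} (h₁ : IsSolution G M ε β Nσ z nc σ u₁ g₁)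
    (h₂ : IsSolution G M ε β Nσ z nc σ u₂ g₂) :
    u₁ =ᵐ[volume.restrict (rescaledFluidDomain G M ε)] u₂ := by
  set U := rescaledFluidDomain G M ε
  have : IsFiniteMeasure (volume.restrict U) := isFiniteMeasure_restrict.2 hU
  have hr₁ := memLp_chargeDensity_comp (z := z) (nc := nc) h₁.memLinfty
  have hr₂ := memLp_chargeDensity_comp (z := z) (nc := nc) h₂.memLinfty
  have hd := h₁.memH1.memLp.sub h₂.memH1.memLp
  have hg := h₁.memH1.memLp_grad.sub h₂.memH1.memLp_grad
  have hr := (hr₁.sub hr₂).const_mul β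
  obtain ⟨φ₁, hφ₁, hu₁, hgr₁⟩ := h₁.dirichlet
  obtain ⟨φ₂, hφ₂, hu₂, hgr₂⟩ := h₂.dirichlet
  -- The differences of the approximating smooth functions are admissible in both equations. The
  -- surface integrals cancel before the limit is taken, so no trace of `u₁ - u₂` is required.
  have hφ := fun k => (hφ₁ k).sub (hφ₂ k)
  have hmem : ∀ k, MemLp (φ₁ k - φ₂ k) 2 (volume.restrict U) := fun k =>
    (lipschitzTest.memLp (hφ k).mem_lipschitzTest 2).restrict U
  have hmemg : ∀ k, MemLp (gradient (φ₁ k - φ₂ k)) 2 (volume.restrict U) := fun k =>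
    (lipschitzTest.memLp_gradient (hφ k).mem_lipschitzTest 2).restrict U
  have hl : Tendsto (fun k => eLpNorm (fun x => (φ₁ k - φ₂ k) x - (u₁ - u₂) x) 2
      (volume.restrict U)) atTop (𝓝 0) := by
    have h := hu₁.add hu₂
    rw [zero_add] at h
    refine tendsto_of_tendsto_of_tendsto_of_le_of_le tendsto_const_nhds h (fun _ => zero_le)
      fun k => ?_
    have e : (fun x => (φ₁ k - φ₂ k) x - (u₁ - u₂) x) =
        (fun x => φ₁ k x - u₁ x) - fun x => φ₂ k x - u₂ x := by
      ext x; simp only [Pi.sub_apply]; ring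
    simp only
    rw [e]
    exact eLpNorm_sub_le
      ((lipschitzTest.continuous (hφ₁ k).mem_lipschitzTest).aestronglyMeasurable.sub
        h₁.memH1.memLp.1)
      ((lipschitzTest.continuous (hφ₂ k).mem_lipschitzTest).aestronglyMeasurable.sub
        h₂.memH1.memLp.1) (by norm_num)
  have hlg : Tendsto (fun k => eLpNorm (fun x => gradient (φ₁ k - φ₂ k) x - (g₁ - g₂) x) 2
      (volume.restrict U)) atTop (𝓝 0) := by
    have h := hgr₁.add hgr₂
    rw [zero_add] at h
    refine tendsto_of_tendsto_of_tendsto_of_le_of_le tendsto_const_nhds h (fun _ => zero_le)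
      fun k => ?_
    have e : (fun x => gradient (φ₁ k - φ₂ k) x - (g₁ - g₂) x) =
        (fun x => gradient (φ₁ k) x - g₁ x) - fun x => gradient (φ₂ k) x - g₂ x := by
      ext1 x
      have e1 : Differentiable ℝ (φ₁ k) := (hφ₁ k).contDiff.differentiable (by simp)
      have e2 : Differentiable ℝ (φ₂ k) := (hφ₂ k).contDiff.differentiable (by simp)
      have e3 : gradient (φ₁ k - φ₂ k) x = gradient (φ₁ k) x - gradient (φ₂ k) x := by
        simp [gradient, fderiv_sub (e1 x) (e2 x)]
      simp only [Pi.sub_apply, e3]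
      abel
    simp only
    rw [e]
    exact eLpNorm_sub_le ((measurable_gradient _).aestronglyMeasurable.sub h₁.memH1.memLp_grad.1)
      ((measurable_gradient _).aestronglyMeasurable.sub h₂.memH1.memLp_grad.1) (by norm_num)
  have heq : ∀ k, ∫ x in U, inner ℝ ((g₁ - g₂) x) (gradient (φ₁ k - φ₂ k) x) =
      ∫ x in U, inner ℝ (β * ((fun x => chargeDensity z nc (u₁ x)) -
        fun x => chargeDensity z nc (u₂ x)) x) ((φ₁ k - φ₂ k) x) := by
    intro k
    have e1 := h₁.equation _ (hφ k)
    have e2 := h₂.equation _ (hφ k)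
    have i1 := integrable_inner_of_memLp h₁.memH1.memLp_grad (hmemg k)
    have i2 := integrable_inner_of_memLp h₂.memH1.memLp_grad (hmemg k)
    have i3 := integrable_inner_of_memLp hr₁ (hmem k)
    have i4 := integrable_inner_of_memLp hr₂ (hmem k)
    have i3' : Integrable (fun x => chargeDensity z nc (u₁ x) * (φ₁ k - φ₂ k) x)
        (volume.restrict U) := by simpa [mul_comm] using i3
    have i4' : Integrable (fun x => chargeDensity z nc (u₂ x) * (φ₁ k - φ₂ k) x)
        (volume.restrict U) := by simpa [mul_comm] using i4
    simp only [Pi.sub_apply (f := g₁), inner_sub_left]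
    rw [integral_sub i1 i2, e1, e2]
    have e3 : ∫ x in U, inner ℝ (β * ((fun x => chargeDensity z nc (u₁ x)) -
        fun x => chargeDensity z nc (u₂ x)) x) ((φ₁ k - φ₂ k) x) =
        ∫ x in U, (β * (chargeDensity z nc (u₁ x) * (φ₁ k - φ₂ k) x) -
          β * (chargeDensity z nc (u₂ x) * (φ₁ k - φ₂ k) x)) := by
      refine integral_congr_ae (Eventually.of_forall fun x => ?_)
      simp only [Pi.sub_apply, RCLike.inner_apply, conj_trivial]
      ring
    rw [e3, integral_sub (i3'.const_mul β) (i4'.const_mul β), integral_const_mul,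
      integral_const_mul]
    ring
  have hlim1 := tendsto_integral_inner hg hg hmemg hlg
  have hlim2 := tendsto_integral_inner hr hd hmem hl
  have hfin := tendsto_nhds_unique (hlim1.congr heq) hlim2
  have hpos : 0 ≤ ∫ x in U, inner ℝ ((g₁ - g₂) x) ((g₁ - g₂) x) :=
    integral_nonneg fun x => real_inner_self_nonneg
  have hi := (integrable_inner_of_memLp hd hd).const_mul c
  have hle : ∫ x in U, c * inner ℝ ((u₁ - u₂) x) ((u₁ - u₂) x) ≤
      -∫ x in U, inner ℝ (β * ((fun x => chargeDensity z nc (u₁ x)) -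
        fun x => chargeDensity z nc (u₂ x)) x) ((u₁ - u₂) x) := by
    rw [← integral_neg]
    refine integral_mono hi (integrable_inner_of_memLp hr hd).neg fun x => ?_
    simp only [Pi.sub_apply, RCLike.inner_apply, conj_trivial]
    rcases le_total (u₁ x) (u₂ x) with h | h
    · have := hmono h
      simp only at this
      nlinarith
    · have := hmono h
      simp only at this
      nlinarith
  have hz : ∫ x in U, c * inner ℝ ((u₁ - u₂) x) ((u₁ - u₂) x) = 0 := by
    refine le_antisymm (by linarith) (integral_nonneg fun x => ?_)
    exact mul_nonneg hc.le real_inner_self_nonneg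
  have hz' := (integral_eq_zero_iff_of_nonneg
    (fun x => mul_nonneg hc.le real_inner_self_nonneg) hi).1 hz
  filter_upwards [hz'] with x hx
  have := (mul_eq_zero.1 hx).resolve_left hc.ne'
  exact sub_eq_zero.1 (inner_self_eq_zero.1 this)

end Uniqueness

/-! ### Exterior balls for the union of the retained grains -/

section Geometry

variable {n : ℕ}

/-- A ball around `p` inside `M` is connected, hence part of the component of `p`, and would make
`p` interior to the grain. -/
lemma frontier_subset_frontier_of_mem_grains {M C : Set (E n)} (hC : C ∈ grains M)
    (hcl : IsClosed C) : frontier C ⊆ frontier M := by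
  obtain ⟨x, hx, rfl⟩ := hC
  intro p hp
  have hpC : p ∈ connectedComponentIn M x := hcl.frontier_subset hp
  refine ⟨subset_closure (connectedComponentIn_subset M x hpC), fun hint => hp.2 ?_⟩
  obtain ⟨s, hs, hsM⟩ := Metric.mem_nhds_iff.1 (mem_interior_iff_mem_nhds.1 hint)
  rw [mem_interior_iff_mem_nhds, Metric.mem_nhds_iff]
  refine ⟨s, hs, ?_⟩
  rw [connectedComponentIn_eq hpC]
  exact (convex_ball p s).isPreconnected.subset_connectedComponentIn (Metric.mem_ball_self hs) hsM

/-- The exterior ball condition for a separated family of grains. -/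
lemma exists_mem_ballCenters {M : Set (E n)} {𝓒 : Set (Set (E n))} (h𝓒 : 𝓒 ⊆ grains M) {r δ : ℝ}
    (hr : 0 < r) (hδ : 0 < δ) (hcl : ∀ C ∈ grains M, IsClosed C)
    (hball : ∀ C ∈ grains M, ExteriorBallCondition C r)
    (hsep : ∀ C ∈ grains M, ∀ C' ∈ grains M, C ≠ C' → ∀ x ∈ C, ∀ y ∈ C', δ ≤ dist x y)
    {p : E n} (hp : p ∈ ⋃ C ∈ 𝓒, frontier C) :
    p ∈ closure (⋃ C ∈ 𝓒, C) ∧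
      ∃ c ∈ ballCenters (⋃ C ∈ 𝓒, C) (min r (δ / 2)), dist c p = min r (δ / 2) := by
  simp only [Set.mem_iUnion, exists_prop] at hp
  obtain ⟨C, hC, hpC⟩ := hp
  have hpC' : p ∈ C := (hcl C (h𝓒 hC)).frontier_subset hpC
  refine ⟨subset_closure (Set.mem_biUnion hC hpC'), ?_⟩
  obtain ⟨c₀, hc₀, hdisj⟩ := hball C (h𝓒 hC) p hpC
  set ρ := min r (δ / 2)
  have hρ : 0 < ρ := lt_min hr (by positivity)
  have hρr : ρ ≤ r := min_le_left _ _
  have hρδ : ρ ≤ δ / 2 := min_le_right _ _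
  have hcp : dist (p + (ρ / r) • (c₀ - p)) p = ρ := by
    rw [dist_eq_norm, add_sub_cancel_left, norm_smul, ← dist_eq_norm, hc₀,
      Real.norm_of_nonneg (by positivity)]
    field_simp
  refine ⟨p + (ρ / r) • (c₀ - p), fun x hx => ?_, hcp⟩
  simp only [Set.mem_iUnion, exists_prop] at hx
  obtain ⟨C', hC', hxC'⟩ := hx
  -- The shrunken ball is internally tangent at `p` to the given exterior ball, so it misses the
  -- grain itself. All its points are within `2ρ ≤ δ` of `p`, so it misses the other grains too.
  by_cases hCC : C = C'
  · subst hCC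
    by_contra! hlt
    suffices hx : x ∈ Metric.ball c₀ r from Set.disjoint_left.1 hdisj hx hxC'
    have hcc : dist (p + (ρ / r) • (c₀ - p)) c₀ = r - ρ := by
      rw [dist_eq_norm, show p + (ρ / r) • (c₀ - p) - c₀ = -((1 - ρ / r) • (c₀ - p)) by module,
        norm_neg, norm_smul, ← dist_eq_norm c₀ p, hc₀, Real.norm_of_nonneg
        (by rw [sub_nonneg, div_le_one hr]; exact hρr)]
      field_simp
    rw [Metric.mem_ball]
    have := dist_triangle x (p + (ρ / r) • (c₀ - p)) c₀
    linarith
  · have h1 := hsep C (h𝓒 hC) C' (h𝓒 hC') hCC p hpC' x hxC'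
    have h2 := dist_triangle p (p + (ρ / r) • (c₀ - p)) x
    rw [dist_comm p (p + (ρ / r) • (c₀ - p)), hcp] at h2
    by_contra! hlt
    rw [dist_comm] at hlt
    linarith

lemma rescaledFluidDomain_eq (G M : Set (E n)) {ε : ℝ} (hε : 0 < ε) :
    rescaledFluidDomain G M ε = ε⁻¹ • G \ closure (⋃ C ∈ retainedGrains G M ε, C) := by
  have hε' : ε⁻¹ ≠ 0 := inv_ne_zero hε.ne'
  rw [rescaledFluidDomain, fluidDomain, Set.smul_set_sdiff₀ hε', ← closure_smul₀' hε']
  congr 2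
  simp only [Set.smul_set_iUnion, smul_smul, inv_mul_cancel₀ hε.ne', one_smul]

end Geometry

/-! ### Energy identity and removal of the truncation -/

section Energy

variable {n m : ℕ} {U : Set (E n)}

lemma integral_norm_sq_add_sq (u : H1Ambient U) :
    ∫ y in U, (‖u.snd y‖ ^ 2 + u.fst y ^ 2) = ‖u‖ ^ 2 := by
  have i1 := integrable_inner_of_memLp (Lp.memLp u.snd) (Lp.memLp u.snd)
  have i2 := integrable_inner_of_memLp (Lp.memLp u.fst) (Lp.memLp u.fst)
  rw [WithLp.prod_norm_sq_eq_of_L2, ← real_inner_self_eq_norm_sq, ← real_inner_self_eq_norm_sq,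
    inner_eq_integral (EventuallyEq.refl _ u.fst) (EventuallyEq.refl _ u.fst),
    inner_eq_integral (EventuallyEq.refl _ u.snd) (EventuallyEq.refl _ u.snd), add_comm,
    ← integral_add i1 i2]
  refine integral_congr_ae (Eventually.of_forall fun y => ?_)
  simp

/-- A bounded solution of the truncated problem solves the Poisson-Boltzmann problem. -/
lemma isSolution_of_truncated {G M : Set (E n)} {ε β Nσ Λ : ℝ} {z : Fin m → ℤ} {nc : Fin m → ℝ}
    {σ : E n → ℝ} (hV : IsOpen (ε⁻¹ • G)) {h : ℝ → ℝ} {K : NNReal} (hK : LipschitzWith K h)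
    (h0 : h 0 = 0) (hh : ∀ s, |s| ≤ Λ → h s = -β * chargeDensity z nc s)
    {u : H1Ambient (rescaledFluidDomain G M ε)}
    (hu : u ∈ h1Space (rescaledFluidDomain G M ε) (ε⁻¹ • G))
    (hb : ∀ᵐ x ∂volume.restrict (rescaledFluidDomain G M ε), |u.fst x| ≤ Λ)
    (heq : ∀ ψ, inner ℝ u.snd (lipschitzEmbedding (rescaledFluidDomain G M ε) (ε⁻¹ • G) ψ).snd +
      inner ℝ (hK.compLp h0 u.fst)
        (lipschitzEmbedding (rescaledFluidDomain G M ε) (ε⁻¹ • G) ψ).fst =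
      -(Nσ * ∫ x in interface G M ε, σ x * ψ.1 x ∂surfaceMeasure n)) :
    IsSolution G M ε β Nσ z nc σ u.fst u.snd where
  memH1 := memH1_of_mem_h1Space hu
  memLinfty := memLp_top_of_bound (Lp.aestronglyMeasurable _) Λ hb
  dirichlet := vanishesOnOuterBoundary_of_mem_h1Space hV hu
  equation φ hφ := by
    have e := heq ⟨φ, hφ.mem_lipschitzTest⟩
    have hcomp : hK.compLp h0 u.fst =ᵐ[volume.restrict (rescaledFluidDomain G M ε)]
        fun x => -β * chargeDensity z nc (u.fst x) := by
      filter_upwards [hK.coeFn_compLp h0 u.fst, hb] with x hx hbx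
      rw [hx, Function.comp_apply, hh _ hbx]
    rw [inner_eq_integral (EventuallyEq.refl _ u.snd) (lipschitzEmbedding_snd _),
      inner_eq_integral hcomp (lipschitzEmbedding_fst _)] at e
    have e2 : ∫ x in rescaledFluidDomain G M ε,
        inner ℝ (-β * chargeDensity z nc (u.fst x)) (φ x) =
        -β * ∫ x in rescaledFluidDomain G M ε, chargeDensity z nc (u.fst x) * φ x := by
      rw [← integral_const_mul]
      refine integral_congr_ae (Eventually.of_forall fun x => ?_)
      simp only [RCLike.inner_apply, conj_trivial]
      ring
    simp only at e
    rw [e2] at e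
    linarith

end Energy

end PoissonBoltzmann

end

/-! ### The main theorem -/

theorem mainTheorem4 {n : ℕ} {Ω : Type*} [MeasurableSpace Ω] (μ : Measure Ω)
    [IsProbabilityMeasure μ]
    -- the random geometry
    (T : PoissonBoltzmann.E n → Ω → Ω) (hT : PoissonBoltzmann.IsErgodicFlow μ T)
    (𝓕 : Set Ω) (h𝓕 : MeasurableSet 𝓕) (h𝓕_pos : 0 < μ 𝓕) (h𝓕_compl : 0 < μ 𝓕ᶜ)
    (hF : ∀ᵐ ω ∂μ, IsOpen (PoissonBoltzmann.poreSpace T 𝓕 ω) ∧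
      IsConnected (PoissonBoltzmann.poreSpace T 𝓕 ω))
    (hM : PoissonBoltzmann.IsDisperseMedium μ (PoissonBoltzmann.skeleton T 𝓕))
    (G : Set (PoissonBoltzmann.E n)) (hG : PoissonBoltzmann.IsBoundedDomain (⊤ : ℕ∞) G)
    -- the physical parameters and electroneutrality
    (β Nσ : ℝ) (hβ : 0 < β) {N : ℕ} (z : Fin (N + 1) → ℤ) (nc : Fin (N + 1) → ℝ)
    (hz : StrictMono z) (hz_neg : z 0 < 0) (hz_pos : 0 < z (Fin.last N))
    (hnc : ∀ j, 0 < nc j) (hneutral : ∑ j, (z j : ℝ) * nc j = 0)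
    -- the surface charge, a bounded function on the boundary of the pore space
    (σ : Ω → PoissonBoltzmann.E n → ℝ) (C₀ : ℝ)
    (hσ : ∀ᵐ ω ∂μ,
      AEStronglyMeasurable (σ ω) ((PoissonBoltzmann.surfaceMeasure n).restrict
        (frontier (PoissonBoltzmann.poreSpace T 𝓕 ω))) ∧
      ∀ᵐ y ∂((PoissonBoltzmann.surfaceMeasure n).restrict
        (frontier (PoissonBoltzmann.poreSpace T 𝓕 ω))), |σ ω y| ≤ C₀) :
    ∃ C : ℝ, ∀ᵐ ω ∂μ, ∀ ε : ℝ, 0 < ε →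
      ∃ (Ψ : PoissonBoltzmann.E n → ℝ) (g : PoissonBoltzmann.E n → PoissonBoltzmann.E n),
        PoissonBoltzmann.IsSolution G (PoissonBoltzmann.skeleton T 𝓕 ω) ε β Nσ z nc (σ ω) Ψ g ∧
        (∀ Ψ' g', PoissonBoltzmann.IsSolution G (PoissonBoltzmann.skeleton T 𝓕 ω) ε β Nσ z nc
            (σ ω) Ψ' g' →
          Ψ' =ᵐ[volume.restrict
            (PoissonBoltzmann.rescaledFluidDomain G (PoissonBoltzmann.skeleton T 𝓕 ω) ε)] Ψ) ∧
        (∫ y in PoissonBoltzmann.rescaledFluidDomain G (PoissonBoltzmann.skeleton T 𝓕 ω) ε,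
            (‖g y‖ ^ 2 + Ψ y ^ 2)) ≤
          C * volume.real
            (PoissonBoltzmann.rescaledFluidDomain G (PoissonBoltzmann.skeleton T 𝓕 ω) ε) ∧
        ∀ᵐ y ∂(volume.restrict
            (PoissonBoltzmann.rescaledFluidDomain G (PoissonBoltzmann.skeleton T 𝓕 ω) ε)),
          |Ψ y| ≤ C := by

  obtain ⟨_, r, hr, hcurv⟩ := hM.curvature
  obtain ⟨δ, hδ, hsep⟩ := hM.separated
  have hρ : 0 < min r (δ / 2) := lt_min hr (by positivity)
  obtain ⟨κ, cB, hκ, hcB, hbar⟩ := PoissonBoltzmann.exists_isBarrier n (min r (δ / 2)) hρ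
  obtain ⟨c, hc, hc1, hmono⟩ :=
    PoissonBoltzmann.exists_monotone_neg_chargeDensity hz_neg hz_pos hnc hβ
  set A := |Nσ| * (|C₀| * cB) with hA
  have hA0 : 0 ≤ A := by positivity
  -- This is the supremum bound of `exists_bounded_solution`. It is known before the truncation is
  -- chosen, so truncating at level `Λ` leaves the solution unaffected.
  set Λ := A * κ / c + A * min r (δ / 2)
  have hΛ : 0 ≤ Λ := by positivity
  obtain ⟨K, h, hK, h0, hhm, hh⟩ := PoissonBoltzmann.exists_truncation
    (f := fun s => -β * PoissonBoltzmann.chargeDensity z nc s)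
    (contDiff_const.mul (PoissonBoltzmann.contDiff_chargeDensity z nc))
    (by simp [PoissonBoltzmann.chargeDensity_zero, hneutral]) hmono hΛ
  refine ⟨max Λ ((2 * A * (κ + 1) / c) ^ 2), ?_⟩
  filter_upwards [hM.smooth, hcurv, hsep, hσ] with ω hsm hcv hsp hσω ε hε
  set M := PoissonBoltzmann.skeleton T 𝓕 ω
  have hcl : ∀ C ∈ PoissonBoltzmann.grains M, IsClosed C := fun C hC => by
    rw [← (hsm C hC).2]
    exact isClosed_closure
  have hVo : IsOpen (ε⁻¹ • G) := hG.isOpen.smul₀ (inv_ne_zero hε.ne')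
  have hVfin : volume (ε⁻¹ • G) ≠ ⊤ := (hG.isBounded.smul₀ _).measure_lt_top.ne
  have hsub : PoissonBoltzmann.retainedGrains G M ε ⊆ PoissonBoltzmann.grains M :=
    fun C hC => hC.1
  -- Only here do `ω` and `ε` enter: the barrier depends on them, its constants do not.
  obtain ⟨W, hW⟩ := hbar _ (PoissonBoltzmann.interface G M ε) fun p hp =>
    PoissonBoltzmann.exists_mem_ballCenters hsub hr hδ hcl (fun C hC => (hcv C hC).2) hsp hp
  have hint : PoissonBoltzmann.interface G M ε ⊆
      frontier (PoissonBoltzmann.poreSpace T 𝓕 ω) := by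
    rw [← frontier_compl]
    exact Set.iUnion₂_subset fun C hC =>
      PoissonBoltzmann.frontier_subset_frontier_of_mem_grains hC.1 (hcl C hC.1)
  have hle := Measure.restrict_mono hint (le_refl (PoissonBoltzmann.surfaceMeasure n))
  have hex := PoissonBoltzmann.exists_bounded_solution hVfin hW hκ hcB
    (hσω.1.mono_measure hle) (ae_mono hle hσω.2) Nσ hK h0 hc hc1 hhm
  rw [← PoissonBoltzmann.rescaledFluidDomain_eq G M hε] at hex
  obtain ⟨u, hu, hnorm, hb, heq⟩ := hex
  have hUfin : volume (PoissonBoltzmann.rescaledFluidDomain G M ε) ≠ ⊤ := by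
    rw [PoissonBoltzmann.rescaledFluidDomain_eq G M hε]
    exact measure_ne_top_of_subset Set.sdiff_subset hVfin
  have hsol := PoissonBoltzmann.isSolution_of_truncated hVo hK h0 hh hu hb heq
  refine ⟨u.fst, u.snd, hsol, fun Ψ' g' h' => h'.ae_eq hUfin hc hmono hsol, ?_, ?_⟩
  · rw [PoissonBoltzmann.integral_norm_sq_add_sq]
    have h1 : ‖u‖ ≤ 2 * A * (κ + 1) / c *
        √(volume.real (PoissonBoltzmann.rescaledFluidDomain G M ε)) := by
      rw [div_mul_eq_mul_div, le_div_iff₀ hc]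
      linarith
    calc ‖u‖ ^ 2 ≤ _ := pow_le_pow_left₀ (norm_nonneg u) h1 2
      _ = (2 * A * (κ + 1) / c) ^ 2 *
          volume.real (PoissonBoltzmann.rescaledFluidDomain G M ε) := by
        rw [mul_pow, Real.sq_sqrt measureReal_nonneg]
      _ ≤ _ := mul_le_mul_of_nonneg_right (le_max_right _ _) measureReal_nonneg
  · filter_upwards [hb] with y hy
    exact hy.trans (le_max_left _ _)
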